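/- Let $G \rightrightarrows M$ be a Lie groupoid with source $s$, target $t$, inversion $i$ and multiplication $m$ ($m(g,h)$ is defined when $s(g)=t(h)$). Here $M$ is a finite-dimensional smooth manifold, and $G$ is a finite-dimensional smooth manifold that is not required to be Hausdorff or second countable; all other manifolds are Hausdorff and second countable. Let $A=\ker(ds)|_M$ be its Lie algebroid, with the bracket of sections induced by the bracket of right-invariant vector fields, and let $\mathcal B$ be a singular subalgebroid of $A$, i.e. an involutive, locally finitely generated $C^\infty(M)$-submodule of $\Gamma_c(A)$. (Locally finitely generated means: every point of $M$ has an open neighbourhood $V$ and finitely many $Y_1,\dots,Y_n\in\Gamma(A|_V)$ such that $fY_j\in\mathcal B$ for all $f\in C_c^\infty(V)$, and every element of $\mathcal B$ with compact support in $V$ is a $C_c^\infty(V)$-linear combination of the $Y_j$.) For $\alpha\in\mathcal B$ let $\overrightarrow{\alpha}_g=(R_g)_*\alpha_{t(g)}$ be the associated right-invariant vector field on $G$ and $\overleftarrow{\alpha}=-i_*\overrightarrow{\alpha}$ the associated left-invariant one. A *bisubmersion* for $\mathcal B$ is a smooth map $\varphi:U\to G$, $U$ a manifold, such that 1. $s_U:=s\circ\varphi$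 and $t_U:=t\circ\varphi$ are submersions $U\to M$; 2. for every $\alpha\in\mathcal B$ there are vector fields $Z,W\in\mathfrak X(U)$ which are $\varphi$-related to $\overrightarrow{\alpha}$ and to $\overleftarrow{\alpha}$ respectively; 3. $\varphi^{-1}(\overrightarrow{\mathcal B})=\Gamma_c(U,\ker ds_U)$ and $\varphi^{-1}(\overleftarrow{\mathcal B})=\Gamma_c(U,\ker dt_U)$, where $\varphi^{-1}(\overrightarrow{\mathcal B})$ is the set of compactly supported smooth vector fields $X$ on $U$ such that $d\varphi(X)$ is a finite sum $\sum_k f_k\,(\overrightarrow{\alpha_k}\circ\varphi)$ with $f_k\in C_c^\infty(U)$ and $\alpha_k\in\mathcal B$, and $\varphi^{-1}(\overleftarrow{\mathcal B})$ is defined in the same way with $\overleftarrow{\alpha_k}$. (If $G$ is Hausdorff and second countable, these are the pullbacks of the $C_c^\infty(G)$-modules spanned by the $\overrightarrow{\alpha}$, respectively the $\overleftarrow{\alpha}$, $\alpha\in\mathcal B$.) Let $\varphi_1:U_1\to G$ and $\varphi_2:U_2\to G$ be bisubmersions for $\mathcal B$. Then the fibre product $U_1\times_{s,t}U_2=\{(u_1,u_2):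 s(\varphi_1(u_1))=t(\varphi_2(u_2))\}$ is an embedded submanifold of $U_1\times U_2$ (possibly empty), and with this manifold structure the composition $$m\circ(\varphi_1,\varphi_2):\;U_1\times_{s,t}U_2\to G$$ is again a bisubmersion for $\mathcal B$. Likewise, the inverse $i\circ\varphi$ of any bisubmersion $\varphi$ for $\mathcal B$ is a bisubmersion for $\mathcal B$. -/

import Mathlib

open scoped Manifold ContDiff

noncomputable section

/-! ### Smooth functions and vector fields with compact support -/

section VectorFields

variable {E : Type*} [NormedAddCommGroup E] [NormedSpace ℝ E]
  {X : Type*} [TopologicalSpace X] [ChartedSpace E X] [IsManifold 𝓘(ℝ, E) ∞ X]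

/-- `f ∈ C_c^∞(X)`, for a Hausdorff manifold `X`. -/
def IsSmoothCc (E : Type*) [NormedAddCommGroup E] [NormedSpace ℝ E]
    {X : Type*} [TopologicalSpace X] [ChartedSpace E X] (f : X → ℝ) : Prop :=
  ContMDiff 𝓘(ℝ, E) 𝓘(ℝ, ℝ) ∞ f ∧ HasCompactSupport f

/-- `Z` is a smooth vector field on `X`, i.e. `Z ∈ 𝔛(X)`. -/
def IsSmoothVF (Z : (x : X) → TangentSpace 𝓘(ℝ, E) x) : Prop :=
  ContMDiff 𝓘(ℝ, E) 𝓘(ℝ, E).tangent ∞ (fun x => (⟨x, Z x⟩ : TangentBundle 𝓘(ℝ, E) X))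

/-- The vector field `Z` vanishes outside a compact set (on a Hausdorff manifold: `Z` has compact
support). -/
def IsCompactlySupportedVF (Z : (x : X) → TangentSpace 𝓘(ℝ, E) x) : Prop :=
  ∃ K : Set X, IsCompact K ∧ ∀ x, x ∉ K → Z x = 0

variable {E' : Type*} [NormedAddCommGroup E'] [NormedSpace ℝ E']
  {Y : Type*} [TopologicalSpace Y] [ChartedSpace E' Y] [IsManifold 𝓘(ℝ, E') ∞ Y]

/-- `Z` is `φ`-related to `V`: `dφ (Z p) = V (φ p)` for all `p`. -/
def IsRelatedVF (φ : X → Y) (Z : (x : X) → TangentSpace 𝓘(ℝ, E) x)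
    (V : (y : Y) → TangentSpace 𝓘(ℝ, E') y) : Prop :=
  ∀ p, mfderiv 𝓘(ℝ, E) 𝓘(ℝ, E') φ p (Z p) = V (φ p)

/-- `Γ_c(X, ker dq)`: the smooth compactly supported vector fields on `X` tangent to the fibres
of `q`. -/
def verticalVF (q : X → Y) : Set ((x : X) → TangentSpace 𝓘(ℝ, E) x) :=
  {Z | IsSmoothVF Z ∧ IsCompactlySupportedVF Z ∧
    ∀ p, mfderiv 𝓘(ℝ, E) 𝓘(ℝ, E') q p (Z p) = 0}

/-- The pullback `φ⁻¹(𝓕)` of a family `𝓕` of vector fields: all `Z ∈ 𝔛_c(X)` for which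
`dφ (Z)` is a finite sum `∑ fᵢ (Vᵢ ∘ φ)` with `fᵢ ∈ C_c^∞(X)` and `Vᵢ ∈ 𝓕`
(real scalars are absorbed in the `fᵢ`). -/
def pullbackVF (φ : X → Y) (𝓕 : Set ((y : Y) → TangentSpace 𝓘(ℝ, E') y)) :
    Set ((x : X) → TangentSpace 𝓘(ℝ, E) x) :=
  {Z | IsSmoothVF Z ∧ IsCompactlySupportedVF Z ∧
    (fun p => mfderiv 𝓘(ℝ, E) 𝓘(ℝ, E') φ p (Z p)) ∈
      Submodule.span ℝ {W : (p : X) → TangentSpace 𝓘(ℝ, E') (φ p) |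
        ∃ f : X → ℝ, IsSmoothCc E f ∧ ∃ V ∈ 𝓕, W = fun p => f p • V (φ p)}}

/-- `Span_{C_c^∞(Y)} 𝓖`, the finite sums `∑ fᵢ Vᵢ` with `fᵢ ∈ C_c^∞(Y)` and `Vᵢ ∈ 𝓖`. -/
def spanCc (𝓖 : Set ((y : Y) → TangentSpace 𝓘(ℝ, E') y)) :
    Set ((y : Y) → TangentSpace 𝓘(ℝ, E') y) :=
  (Submodule.span ℝ {W : (y : Y) → TangentSpace 𝓘(ℝ, E') y |
    ∃ g : Y → ℝ, IsSmoothCc E' g ∧ ∃ V ∈ 𝓖, W = fun y => g y • V y} : Submodule ℝ _)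

/-- On a Hausdorff target, pulling back the `C_c^∞`-module spanned by `𝓖` is the same as pulling
back `𝓖` itself. On a non-Hausdorff target, where `C_c^∞(Y)` need not contain bump functions, the
right-hand side is the meaningful one, and it is the one used below. -/
theorem pullbackVF_spanCc [FiniteDimensional ℝ E'] [T2Space Y] [SecondCountableTopology Y]
    {φ : X → Y} (hφ : ContMDiff 𝓘(ℝ, E) 𝓘(ℝ, E') ∞ φ)
    (𝓖 : Set ((y : Y) → TangentSpace 𝓘(ℝ, E') y)) :
    (pullbackVF φ (spanCc 𝓖) : Set ((x : X) → TangentSpace 𝓘(ℝ, E) x)) = pullbackVF φ 𝓖 := by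
  have : LocallyCompactSpace Y := ChartedSpace.locallyCompactSpace E' Y
  have key : Submodule.span ℝ {W : (p : X) → TangentSpace 𝓘(ℝ, E') (φ p) |
        ∃ f : X → ℝ, IsSmoothCc E f ∧ ∃ V ∈ spanCc 𝓖, W = fun p => f p • V (φ p)} =
      Submodule.span ℝ {W : (p : X) → TangentSpace 𝓘(ℝ, E') (φ p) |
        ∃ f : X → ℝ, IsSmoothCc E f ∧ ∃ V ∈ 𝓖, W = fun p => f p • V (φ p)} := by
    apply le_antisymm
    · rw [Submodule.span_le]
      rintro W ⟨f, hf, V, hV, rfl⟩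
      refine Submodule.span_induction (p := fun V _ => (fun p => f p • V (φ p)) ∈
        Submodule.span ℝ {W : (p : X) → TangentSpace 𝓘(ℝ, E') (φ p) |
          ∃ f : X → ℝ, IsSmoothCc E f ∧ ∃ V ∈ 𝓖, W = fun p => f p • V (φ p)})
        ?_ ?_ ?_ ?_ hV
      · rintro _ ⟨g, hg, V, hV, rfl⟩
        refine Submodule.subset_span ⟨fun p => f p * g (φ p), ⟨?_, ?_⟩, V, hV, ?_⟩
        · exact hf.1.mul (hg.1.comp hφ)
        · exact hf.2.mul_right
        · funext p
          exact smul_smul (f p) (g (φ p)) (V (φ p))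
      · convert Submodule.zero_mem _ using 1
        funext p
        exact smul_zero (f p)
      · intro V W _ _ hV hW
        convert Submodule.add_mem _ hV hW using 1
        funext p
        exact smul_add (f p) (V (φ p)) (W (φ p))
      · intro c V _ hV
        convert Submodule.smul_mem _ c hV using 1
        funext p
        exact smul_comm (f p) c (V (φ p))
    · refine Submodule.span_mono ?_
      rintro W ⟨f, hf, V, hV, rfl⟩
      have hK : IsCompact (φ '' tsupport f) := hf.2.isCompact.image hφ.continuous
      obtain ⟨L, hL, hKL⟩ := exists_compact_superset hK
      obtain ⟨g, hg1, hg0, -⟩ := exists_contMDiffMap_one_nhds_of_subset_interior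
        𝓘(ℝ, E') (n := (⊤ : ℕ∞)) hK.isClosed hKL
      refine ⟨f, hf, fun y => g y • V y, Submodule.subset_span ⟨g, ⟨g.contMDiff, ?_⟩, V, hV, rfl⟩, ?_⟩
      · exact HasCompactSupport.intro hL hg0
      · funext p
        by_cases hp : f p = 0
        · simp [hp]
        · have h1 : g (φ p) = 1 := hg1.self_of_nhdsSet _ ⟨p, subset_tsupport f hp, rfl⟩
          simp [h1]
  ext Z
  simp only [pullbackVF, key]

end VectorFields

/-! ### Lie groupoids -/

/-- A Lie groupoid `G ⇉ M`. Two arrows `g`, `h` are composable if `src g = tgt h`; the values of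
`mul` on other pairs are irrelevant. The composable pairs form an embedded submanifold of `G × G`,
so that `ContMDiffOn` on this set is smoothness of the multiplication. `G` need not be
Hausdorff. -/
structure LieGrpd (EM EG : Type*) [NormedAddCommGroup EM] [NormedSpace ℝ EM]
    [NormedAddCommGroup EG] [NormedSpace ℝ EG]
    (M G : Type*) [TopologicalSpace M] [ChartedSpace EM M] [IsManifold 𝓘(ℝ, EM) ∞ M]
    [TopologicalSpace G] [ChartedSpace EG G] [IsManifold 𝓘(ℝ, EG) ∞ G] where
  src : G → M
  tgt : G → M
  one : M → G
  inv : G → G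
  mul : G → G → G
  src_one : ∀ x, src (one x) = x
  tgt_one : ∀ x, tgt (one x) = x
  src_mul : ∀ g h, src g = tgt h → src (mul g h) = src h
  tgt_mul : ∀ g h, src g = tgt h → tgt (mul g h) = tgt g
  mul_assoc : ∀ g h k, src g = tgt h → src h = tgt k → mul (mul g h) k = mul g (mul h k)
  one_mul : ∀ g, mul (one (tgt g)) g = g
  mul_one : ∀ g, mul g (one (src g)) = g
  src_inv : ∀ g, src (inv g) = tgt g
  tgt_inv : ∀ g, tgt (inv g) = src g
  inv_mul : ∀ g, mul (inv g) g = one (src g)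
  mul_inv : ∀ g, mul g (inv g) = one (tgt g)
  src_submersion : Manifold.IsSubmersion 𝓘(ℝ, EG) 𝓘(ℝ, EM) ∞ src
  tgt_submersion : Manifold.IsSubmersion 𝓘(ℝ, EG) 𝓘(ℝ, EM) ∞ tgt
  one_smooth : ContMDiff 𝓘(ℝ, EM) 𝓘(ℝ, EG) ∞ one
  inv_smooth : ContMDiff 𝓘(ℝ, EG) 𝓘(ℝ, EG) ∞ inv
  mul_smooth : ContMDiffOn (𝓘(ℝ, EG).prod 𝓘(ℝ, EG)) 𝓘(ℝ, EG) ∞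
    (fun p : G × G => mul p.1 p.2) {p | src p.1 = tgt p.2}

namespace LieGrpd

variable {EM EG : Type*} [NormedAddCommGroup EM] [NormedSpace ℝ EM]
  [NormedAddCommGroup EG] [NormedSpace ℝ EG]
  {M G : Type*} [TopologicalSpace M] [ChartedSpace EM M] [IsManifold 𝓘(ℝ, EM) ∞ M]
  [TopologicalSpace G] [ChartedSpace EG G] [IsManifold 𝓘(ℝ, EG) ∞ G]

/-- `α` is, over the set `V`, a smooth section of the Lie algebroid `A = (ker d src)|_M`. -/
def IsSectionOn (𝒢 : LieGrpd EM EG M G) (V : Set M)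
    (α : (x : M) → TangentSpace 𝓘(ℝ, EG) (𝒢.one x)) : Prop :=
  ContMDiffOn 𝓘(ℝ, EM) 𝓘(ℝ, EG).tangent ∞
    (fun x => (⟨𝒢.one x, α x⟩ : TangentBundle 𝓘(ℝ, EG) G)) V ∧
  ∀ x ∈ V, mfderiv 𝓘(ℝ, EG) 𝓘(ℝ, EM) 𝒢.src (𝒢.one x) (α x) = 0

/-- The right-invariant vector field `g ↦ (R_g)_* α_{t(g)}` on `G`, where `R_g h = h g` is defined
on the source fibre `s⁻¹(t(g))`. The value is a tangent vector at `1_{t(g)} g = g`. As `α_{t(g)}` is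
tangent to that source fibre, the value does not depend on how the derivative within the fibre is
extended to the other directions. -/
def rightInvVF (𝒢 : LieGrpd EM EG M G) (α : (x : M) → TangentSpace 𝓘(ℝ, EG) (𝒢.one x)) (g : G) :
    TangentSpace 𝓘(ℝ, EG) g :=
  mfderivWithin 𝓘(ℝ, EG) 𝓘(ℝ, EG) (fun h => 𝒢.mul h g) {h | 𝒢.src h = 𝒢.tgt g}
    (𝒢.one (𝒢.tgt g)) (α (𝒢.tgt g))

/-- The left-invariant vector field `- i_* (rightInvVF α)`, where `i` is the inversion. -/
def leftInvVF (𝒢 : LieGrpd EM EG M G) (α : (x : M) → TangentSpace 𝓘(ℝ, EG) (𝒢.one x)) (g : G) :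
    TangentSpace 𝓘(ℝ, EG) g :=
  -(mfderiv 𝓘(ℝ, EG) 𝓘(ℝ, EG) 𝒢.inv (𝒢.inv g) (𝒢.rightInvVF α (𝒢.inv g)) : EG)

/-- The Lie bracket of sections of `A`: the restriction to the units of the bracket of the
associated right-invariant vector fields. -/
def bracket (𝒢 : LieGrpd EM EG M G) (α β : (x : M) → TangentSpace 𝓘(ℝ, EG) (𝒢.one x)) (x : M) :
    TangentSpace 𝓘(ℝ, EG) (𝒢.one x) :=
  VectorField.mlieBracket 𝓘(ℝ, EG) (𝒢.rightInvVF α) (𝒢.rightInvVF β) (𝒢.one x)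

end LieGrpd

/-! ### Singular subalgebroids and bisubmersions -/

/-- A singular subalgebroid of the Lie algebroid `A` of `𝒢`: an involutive, locally finitely
generated `C^∞(M)`-submodule of `Γ_c(A)`. In `locally_fg`, functions in `C_c^∞(V)` and sections in
`Γ_c(A|_V)` are identified with their extensions by zero; the `Y j` matter only on `V`, and belong to
the global hull of the restriction of the submodule to `V`. -/
structure SingularSubalgebroid {EM EG : Type*} [NormedAddCommGroup EM] [NormedSpace ℝ EM]
    [NormedAddCommGroup EG] [NormedSpace ℝ EG]
    {M G : Type*} [TopologicalSpace M] [ChartedSpace EM M] [IsManifold 𝓘(ℝ, EM) ∞ M]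
    [TopologicalSpace G] [ChartedSpace EG G] [IsManifold 𝓘(ℝ, EG) ∞ G] (𝒢 : LieGrpd EM EG M G) where
  carrier : Submodule ℝ ((x : M) → TangentSpace 𝓘(ℝ, EG) (𝒢.one x))
  isSection : ∀ α ∈ carrier, 𝒢.IsSectionOn Set.univ α
  compactSupport : ∀ α ∈ carrier, ∃ K : Set M, IsCompact K ∧ ∀ x, x ∉ K → α x = 0
  smul_mem : ∀ f : M → ℝ, ContMDiff 𝓘(ℝ, EM) 𝓘(ℝ, ℝ) ∞ f →
    ∀ α ∈ carrier, (fun x => f x • α x) ∈ carrier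
  involutive : ∀ α ∈ carrier, ∀ β ∈ carrier, 𝒢.bracket α β ∈ carrier
  locally_fg : ∀ x : M, ∃ V : Set M, IsOpen V ∧ x ∈ V ∧
    ∃ (n : ℕ) (Y : Fin n → (y : M) → TangentSpace 𝓘(ℝ, EG) (𝒢.one y)),
      (∀ j, 𝒢.IsSectionOn V (Y j)) ∧
      (∀ j, ∀ f : M → ℝ, IsSmoothCc EM f → tsupport f ⊆ V → (fun y => f y • Y j y) ∈ carrier) ∧
      ∀ α ∈ carrier, (∃ K : Set M, IsCompact K ∧ K ⊆ V ∧ ∀ y, y ∉ K → α y = 0) →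
        ∃ f : Fin n → M → ℝ, (∀ j, IsSmoothCc EM (f j) ∧ tsupport (f j) ⊆ V) ∧
          α = fun y => ∑ j, f j y • Y j y

section Bisubmersion

variable {EM EG EU : Type*} [NormedAddCommGroup EM] [NormedSpace ℝ EM]
  [NormedAddCommGroup EG] [NormedSpace ℝ EG] [NormedAddCommGroup EU] [NormedSpace ℝ EU]
  {M G U : Type*} [TopologicalSpace M] [ChartedSpace EM M] [IsManifold 𝓘(ℝ, EM) ∞ M]
  [TopologicalSpace G] [ChartedSpace EG G] [IsManifold 𝓘(ℝ, EG) ∞ G] [TopologicalSpace U] [ChartedSpace EU U] [IsManifold 𝓘(ℝ, EU) ∞ U]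
  {𝒢 : LieGrpd EM EG M G}

/-- The right-invariant vector fields of the sections in `B`; they generate the singular
foliation on `G` defined by `B` and right translations. -/
def SingularSubalgebroid.rightVFs (B : SingularSubalgebroid 𝒢) :
    Set ((g : G) → TangentSpace 𝓘(ℝ, EG) g) :=
  {V | ∃ α ∈ B.carrier, V = 𝒢.rightInvVF α}

/-- The left-invariant vector fields of the sections in `B`. -/
def SingularSubalgebroid.leftVFs (B : SingularSubalgebroid 𝒢) :
    Set ((g : G) → TangentSpace 𝓘(ℝ, EG) g) :=
  {V | ∃ α ∈ B.carrier, V = 𝒢.leftInvVF α}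

/-- The smooth map `φ : U → G` is a bisubmersion for `B`. -/
structure IsBisubmersion (B : SingularSubalgebroid 𝒢) (φ : U → G) : Prop where
  smooth : ContMDiff 𝓘(ℝ, EU) 𝓘(ℝ, EG) ∞ φ
  src_submersion : Manifold.IsSubmersion 𝓘(ℝ, EU) 𝓘(ℝ, EM) ∞ (𝒢.src ∘ φ)
  tgt_submersion : Manifold.IsSubmersion 𝓘(ℝ, EU) 𝓘(ℝ, EM) ∞ (𝒢.tgt ∘ φ)
  lift_right : ∀ α ∈ B.carrier, ∃ Z : (u : U) → TangentSpace 𝓘(ℝ, EU) u,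
    IsSmoothVF Z ∧ IsRelatedVF φ Z (𝒢.rightInvVF α)
  lift_left : ∀ α ∈ B.carrier, ∃ W : (u : U) → TangentSpace 𝓘(ℝ, EU) u,
    IsSmoothVF W ∧ IsRelatedVF φ W (𝒢.leftInvVF α)
  pullback_right : (pullbackVF φ B.rightVFs : Set ((u : U) → TangentSpace 𝓘(ℝ, EU) u)) =
    verticalVF (E' := EM) (𝒢.src ∘ φ)
  pullback_left : (pullbackVF φ B.leftVFs : Set ((u : U) → TangentSpace 𝓘(ℝ, EU) u)) =
    verticalVF (E' := EM) (𝒢.tgt ∘ φ)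

variable {U₁ U₂ : Type*}

/-- The fibre product `U₁ ×_{s,t} U₂` of `s ∘ φ₁` and `t ∘ φ₂`, a subset of `U₁ × U₂`. -/
def LieGrpd.fiberProd (𝒢 : LieGrpd EM EG M G) (φ₁ : U₁ → G) (φ₂ : U₂ → G) : Set (U₁ × U₂) :=
  {p | 𝒢.src (φ₁ p.1) = 𝒢.tgt (φ₂ p.2)}

/-- The composition `m ∘ (φ₁, φ₂) : U₁ ×_{s,t} U₂ → G`. -/
def LieGrpd.compMap (𝒢 : LieGrpd EM EG M G) (φ₁ : U₁ → G) (φ₂ : U₂ → G) :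
    𝒢.fiberProd φ₁ φ₂ → G :=
  fun p => 𝒢.mul (φ₁ p.1.1) (φ₂ p.1.2)

end Bisubmersion

end

noncomputable section

open scoped Topology
open Filter

/-! ### Smoothness of vector fields and of their images under differentials -/

section
variable {E H : Type*} [NormedAddCommGroup E] [NormedSpace ℝ E] [TopologicalSpace H]
  {I : ModelWithCorners ℝ E H} {X : Type*} [TopologicalSpace X] [ChartedSpace H X]
  [IsManifold I ∞ X]
  {E' H' : Type*} [NormedAddCommGroup E'] [NormedSpace ℝ E'] [TopologicalSpace H']
  {I' : ModelWithCorners ℝ E' H'} {Y : Type*} [TopologicalSpace Y] [ChartedSpace H' Y]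
  [IsManifold I' ∞ Y]

/-! The heart of the matter is the composition, and there the inclusion of the vertical fields in
the pullback. Write `g = φ₁ u₁`, `h = φ₂ u₂`, and let `(x₁, x₂)` be tangent to the fibre product and
killed by the differential of `s (g h) = s h`. Then `x₂` is vertical for `s ∘ φ₂`, so condition 3
for `φ₂` gives `dφ₂ x₂ = ∑ aⱼ r(αⱼ)`, where `r(α)` and `l(α)` denote the right- and left-invariant
fields of `α`. Lift each `l(αⱼ)` through `φ₁` to a field `Wⱼ`. The anchors of `l(α)` and `r(α)` are
opposite, so `x₁ + ∑ aⱼ Wⱼ` is vertical for `s ∘ φ₁`, and condition 3 for `φ₁` expresses its image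
by right-invariant fields. Finally `dm (-l(α), r(α)) = 0`, because `(g γ⁻¹) (γ h) = g h`, so this
correction does not change the product vector; and `dm (r(α), 0) = r(α)` by associativity.
`map_pair_eq_sum` is this computation.

The coefficients must also be smooth, although the projections of a field on the fibre product are
not fields on `U₁` and `U₂`. Hence vertical vectors are expanded in local frames whose coefficients
are differentials of smooth functions (`exists_vertical_frame`). Condition 3 is applied to the frame
fields only, and a partition of unity globalises the result (`mem_pullbackVF_of_local`).

The opposite inclusion holds since right-invariant fields are tangent to the source fibres. A
right-invariant field is lifted by the pair (lift through `φ₁`, zero). All statements about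
left-invariant fields follow by inversion, which exchanges the two kinds of fields up to sign and
turns `φ₁ · φ₂` into `φ₂⁻¹ · φ₁⁻¹`. This also proves the claim on inverses.

The fibre product is an embedded submanifold because a submersion chart of `s ∘ φ₁`, sheared by `t ∘
φ₂`, flattens it. The composition argument uses only the properties in `IsSmoothFiberProduct`, which
hold for any manifold structure that makes the inclusion a smooth embedding. -/

theorem ContMDiffAt.mfderiv_section {f : X → Y} {x₀ : X} (hf : ContMDiffAt I I' ∞ f x₀)
    {Z : (x : X) → TangentSpace I x}
    (hZ : ContMDiffAt I I.tangent ∞ (fun x => (⟨x, Z x⟩ : TangentBundle I X)) x₀) :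
    ContMDiffAt I I'.tangent ∞
      (fun x => (⟨f x, mfderiv I I' f x (Z x)⟩ : TangentBundle I' Y)) x₀ := by
  have : IsManifold I 1 X := IsManifold.of_le (n := ∞) (by simp)
  have : IsManifold I' 1 Y := IsManifold.of_le (n := ∞) (by simp)
  exact ContMDiffAt.clm_apply_of_inCoordinates (hf.mfderiv_const (m := ∞) (by simp)) hZ hf

theorem ContMDiffAt.mfderiv_apply_section {F : Type*} [NormedAddCommGroup F] [NormedSpace ℝ F]
    {f : X → F} {x₀ : X} (hf : ContMDiffAt I 𝓘(ℝ, F) ∞ f x₀)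
    {Z : (x : X) → TangentSpace I x}
    (hZ : ContMDiffAt I I.tangent ∞ (fun x => (⟨x, Z x⟩ : TangentBundle I X)) x₀) :
    ContMDiffAt I 𝓘(ℝ, F) ∞ (fun x => (mfderiv I 𝓘(ℝ, F) f x (Z x) : F)) x₀ := by
  have h := hf.mfderiv_section hZ
  exact (contMDiff_snd_tangentBundle_modelSpace F 𝓘(ℝ, F)).contMDiffAt.comp x₀ h

/-- The tangent trivialization at `x₀` is the differential of the chart at `x₀`. Smoothness of a
field thus becomes smoothness of a vector-valued function. -/
theorem contMDiffAt_section_iff_mfderiv_extChartAt {Z : (x : X) → TangentSpace I x} {x₀ : X} :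
    ContMDiffAt I I.tangent ∞ (fun x => (⟨x, Z x⟩ : TangentBundle I X)) x₀ ↔
      ContMDiffAt I 𝓘(ℝ, E) ∞ (fun x => (mfderiv I 𝓘(ℝ, E) (extChartAt I x₀) x (Z x) : E)) x₀ := by
  have : IsManifold I 1 X := IsManifold.of_le (n := ∞) (by simp)
  rw [Bundle.contMDiffAt_section]
  refine Filter.EventuallyEq.contMDiffAt_iff ?_
  filter_upwards [chart_source_mem_nhds H x₀] with x hx
  have h₁ := TangentBundle.continuousLinearMapAt_trivializationAt (I := I) hx
  have h₂ := Bundle.Trivialization.continuousLinearMapAt_apply_of_mem (R := ℝ)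
    (trivializationAt E (TangentSpace I : X → Type _) x₀) (b := x) hx
  exact (h₂ (Z x)).symm.trans (congrArg (fun L : E →L[ℝ] E => L (Z x)) h₁)

end
-- Local sections of submersions
section Submersion

variable {E : Type*} [NormedAddCommGroup E] [NormedSpace ℝ E]
  {U : Type*} [TopologicalSpace U] [ChartedSpace E U]
  {E' : Type*} [NormedAddCommGroup E'] [NormedSpace ℝ E']
  {M : Type*} [TopologicalSpace M] [ChartedSpace E' M]

theorem Manifold.IsSubmersionAtOfComplement.exists_charts
    {F : Type*} [NormedAddCommGroup F] [NormedSpace ℝ F] {q : U → M} {u₀ : U}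
    (hq : Manifold.IsSubmersionAtOfComplement F 𝓘(ℝ, E) 𝓘(ℝ, E') ∞ q u₀) :
    ∃ (ψ : OpenPartialHomeomorph U E) (χ : OpenPartialHomeomorph M E') (e : E ≃L[ℝ] E' × F),
      ψ ∈ IsManifold.maximalAtlas 𝓘(ℝ, E) ∞ U ∧ χ ∈ IsManifold.maximalAtlas 𝓘(ℝ, E') ∞ M ∧
      u₀ ∈ ψ.source ∧ (∀ u ∈ ψ.source, q u ∈ χ.source) ∧
      ∀ u ∈ ψ.source, (e (ψ u)).1 = χ (q u) := by
  obtain ⟨ψ, χ, h₁, -, h₂, h₃, h₄, e, he⟩ := hq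
  refine ⟨ψ, χ, e, h₂, h₃, h₁, fun u hu => h₄ hu, fun u hu => ?_⟩
  have h := he (x := ψ u) (by simpa using ψ.map_source hu)
  simpa [hu] using h.symm

/-- A submersion `q` admits, near `u₀`, smooth local sections `σ (·, u)` through all points `u`. -/
theorem Manifold.IsSubmersionAt.exists_sections [IsManifold 𝓘(ℝ, E) ∞ U]
    [IsManifold 𝓘(ℝ, E') ∞ M] {q : U → M} {u₀ : U}
    (hq : Manifold.IsSubmersionAt 𝓘(ℝ, E) 𝓘(ℝ, E') ∞ q u₀) :
    ∃ σ : M × U → U, ContMDiffAt (𝓘(ℝ, E').prod 𝓘(ℝ, E)) 𝓘(ℝ, E) ∞ σ (q u₀, u₀) ∧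
      (∀ᶠ p in 𝓝 (q u₀, u₀), q (σ p) = p.1) ∧ ∀ᶠ u in 𝓝 u₀, σ (q u, u) = u := by
  obtain ⟨F, _, _, hq⟩ := hq
  have hqc := hq.contMDiffAt.continuousAt
  obtain ⟨ψ, χ, e, hψ, hχ, hu₀, hs, hqψ⟩ := hq.exists_charts
  -- In the submersion charts, keep the fibre coordinates of `p.2` and replace its base coordinates
  -- by those of `p.1`.
  set τ : M × U → E := fun p => e.symm (χ p.1, (e (ψ p.2)).2) with hτ
  have hτ₀ : τ (q u₀, u₀) = ψ u₀ := by
    simp only [hτ, ← hqψ u₀ hu₀, Prod.mk.eta, e.symm_apply_apply]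
  have hχ' : ContMDiffAt 𝓘(ℝ, E') 𝓘(ℝ, E') ∞ χ (q u₀) :=
    contMDiffAt_of_mem_maximalAtlas hχ (hs _ hu₀)
  have hψ' : ContMDiffAt 𝓘(ℝ, E) 𝓘(ℝ, E) ∞ ψ u₀ := contMDiffAt_of_mem_maximalAtlas hψ hu₀
  have hψs : ContMDiffAt 𝓘(ℝ, E) 𝓘(ℝ, E) ∞ ψ.symm (ψ u₀) :=
    contMDiffAt_symm_of_mem_maximalAtlas hψ (ψ.map_source hu₀)
  have hτs : ContMDiffAt (𝓘(ℝ, E').prod 𝓘(ℝ, E)) 𝓘(ℝ, E) ∞ τ (q u₀, u₀) := by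
    have h₁ : ContMDiffAt (𝓘(ℝ, E').prod 𝓘(ℝ, E)) 𝓘(ℝ, E') ∞ (fun p : M × U => χ p.1) (q u₀, u₀) :=
      hχ'.comp (q u₀, u₀) contMDiffAt_fst
    have h₂ : ContMDiffAt (𝓘(ℝ, E').prod 𝓘(ℝ, E)) 𝓘(ℝ, E) ∞ (fun p : M × U => ψ p.2) (q u₀, u₀) :=
      hψ'.comp (q u₀, u₀) contMDiffAt_snd
    have h₃ : ContMDiffAt (𝓘(ℝ, E').prod 𝓘(ℝ, E)) 𝓘(ℝ, F) ∞
        (fun p : M × U => (e (ψ p.2)).2) (q u₀, u₀) := by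
      have : ContDiff ℝ ∞ fun v : E => (e v).2 := by fun_prop
      exact this.contMDiff.contMDiffAt.comp _ h₂
    have h₄ : ContDiff ℝ ∞ e.symm := e.symm.contDiff
    exact h₄.contMDiff.contMDiffAt.comp _ (h₁.prodMk_space h₃)
  refine ⟨fun p => ψ.symm (τ p), ContMDiffAt.comp _ (by rwa [hτ₀]) hτs, ?_, ?_⟩
  · have h₁ : ∀ᶠ p in 𝓝 (q u₀, u₀), τ p ∈ ψ.target :=
      hτs.continuousAt.eventually (by rw [hτ₀]; exact ψ.open_target.mem_nhds (ψ.map_source hu₀))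
    have h₂ : ∀ᶠ p : M × U in 𝓝 (q u₀, u₀), p.1 ∈ χ.source :=
      continuousAt_fst.eventually (χ.open_source.mem_nhds (hs _ hu₀))
    filter_upwards [h₁, h₂] with p hp₁ hp₂
    have hm := ψ.map_target hp₁
    apply χ.injOn (hs _ hm) hp₂
    rw [← hqψ _ hm, ψ.right_inv hp₁]
    simp [hτ]
  · filter_upwards [ψ.open_source.mem_nhds hu₀] with u hu
    simp only [hτ, ← hqψ u hu, Prod.mk.eta, e.symm_apply_apply]
    exact ψ.left_inv hu

end Submersion

/-! ### Tangent vectors as velocities of curves -/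

section Velocity

variable {E : Type*} [NormedAddCommGroup E] [NormedSpace ℝ E]
  {X : Type*} [TopologicalSpace X] [ChartedSpace E X]
  {E' : Type*} [NormedAddCommGroup E'] [NormedSpace ℝ E']
  {Y : Type*} [TopologicalSpace Y] [ChartedSpace E' Y]

/-- The curve `c` is smooth at `0`, where it passes through `x` with velocity `v`. -/
def HasVelocity (c : ℝ → X) (x : X) (v : TangentSpace 𝓘(ℝ, E) x) : Prop :=
  c 0 = x ∧ ContMDiffAt 𝓘(ℝ, ℝ) 𝓘(ℝ, E) ∞ c 0 ∧
    (mfderiv 𝓘(ℝ, ℝ) 𝓘(ℝ, E) c 0 (1 : ℝ) : E) = v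

namespace HasVelocity

theorem mdifferentiableAt {c : ℝ → X} {x : X} {v : TangentSpace 𝓘(ℝ, E) x}
    (h : HasVelocity c x v) : MDifferentiableAt 𝓘(ℝ, ℝ) 𝓘(ℝ, E) c 0 :=
  h.2.1.mdifferentiableAt (by simp)

theorem continuousAt {c : ℝ → X} {x : X} {v : TangentSpace 𝓘(ℝ, E) x}
    (h : HasVelocity c x v) : Filter.Tendsto c (𝓝 0) (𝓝 x) := by
  have := h.2.1.continuousAt
  rwa [ContinuousAt, h.1] at this

/-- The tool behind most tangent vector identities below: realise both sides as velocities of curves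
that agree near `0`. -/
theorem unique {c c' : ℝ → X} {x : X} {v v' : TangentSpace 𝓘(ℝ, E) x} (h : HasVelocity c x v)
    (h' : HasVelocity c' x v') (hc : c =ᶠ[𝓝 0] c') : v = v' := by
  have := hc.mfderiv_eq (I := 𝓘(ℝ, ℝ)) (I' := 𝓘(ℝ, E))
  exact h.2.2.symm.trans ((congrArg (fun L : ℝ →L[ℝ] E => L 1) this).trans h'.2.2)

theorem congr {c c' : ℝ → X} {x : X} {v : TangentSpace 𝓘(ℝ, E) x} (h : HasVelocity c x v)
    (hc : c' =ᶠ[𝓝 0] c) : HasVelocity c' x v := by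
  refine ⟨hc.self_of_nhds.trans h.1, h.2.1.congr_of_eventuallyEq hc, ?_⟩
  have := hc.mfderiv_eq (I := 𝓘(ℝ, ℝ)) (I' := 𝓘(ℝ, E))
  exact (congrArg (fun L : ℝ →L[ℝ] E => L 1) this).trans h.2.2

/-- All tangent spaces are by definition the model space `E`, so a change of base point along an
equality leaves the vector itself untouched. -/
theorem cast {c : ℝ → X} {x y : X} {v : TangentSpace 𝓘(ℝ, E) x} (h : HasVelocity c x v)
    (hxy : x = y) : HasVelocity c y (v : E) :=
  ⟨h.1.trans hxy, h.2⟩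

theorem const (x : X) : HasVelocity (fun _ => x) x (0 : TangentSpace 𝓘(ℝ, E) x) :=
  ⟨rfl, contMDiffAt_const, by
    exact congrArg (fun L : ℝ →L[ℝ] E => L 1) (mfderiv_const (I := 𝓘(ℝ, ℝ)) (I' := 𝓘(ℝ, E)))⟩

/-- Derivatives within a subset, evaluated along curves in that subset. -/
theorem comp_within {c : ℝ → X} {x : X} {v : TangentSpace 𝓘(ℝ, E) x} (h : HasVelocity c x v)
    {f : X → Y} {S : Set X} (hf : ContMDiffWithinAt 𝓘(ℝ, E) 𝓘(ℝ, E') ∞ f S x)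
    (hS : ∀ᶠ τ in 𝓝 0, c τ ∈ S) :
    HasVelocity (f ∘ c) (f x) (mfderivWithin 𝓘(ℝ, E) 𝓘(ℝ, E') f S x v) := by
  obtain ⟨rfl, h₂, rfl⟩ := h
  refine ⟨rfl, ?_, ?_⟩
  · have : ContMDiffWithinAt 𝓘(ℝ, ℝ) 𝓘(ℝ, E') ∞ (f ∘ c) (c ⁻¹' S) 0 :=
      hf.comp 0 h₂.contMDiffWithinAt (fun _ h => h)
    exact this.contMDiffAt hS
  · have h₃ := (hf.mdifferentiableWithinAt (by simp)).hasMFDerivWithinAt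
    have h₄ := (h₂.mdifferentiableAt (by simp)).hasMFDerivAt
    have h₅ := (h₃.comp 0 h₄.hasMFDerivWithinAt (s := c ⁻¹' S) (fun _ h => h)).hasMFDerivAt hS
    rw [h₅.mfderiv]
    rfl

theorem comp {c : ℝ → X} {x : X} {v : TangentSpace 𝓘(ℝ, E) x} (h : HasVelocity c x v)
    {f : X → Y} (hf : ContMDiffAt 𝓘(ℝ, E) 𝓘(ℝ, E') ∞ f x) :
    HasVelocity (f ∘ c) (f x) (mfderiv 𝓘(ℝ, E) 𝓘(ℝ, E') f x v) := by
  rw [← mfderivWithin_univ]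
  exact h.comp_within hf.contMDiffWithinAt (by simp)

end HasVelocity

theorem hasVelocity_line (x v : E) :
    HasVelocity (E := E) (fun τ : ℝ => x + τ • v) x (v : TangentSpace 𝓘(ℝ, E) x) := by
  refine ⟨by simp, ?_, ?_⟩
  · apply ContDiffAt.contMDiffAt
    fun_prop
  · rw [mfderiv_eq_fderiv]
    have : HasFDerivAt (fun τ : ℝ => x + τ • v)
      ((ContinuousLinearMap.id ℝ ℝ).smulRight v) 0 :=
      ((hasFDerivAt_id (0 : ℝ)).smul_const v).const_add _
    rw [this.fderiv]
    exact one_smul ℝ v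

theorem HasVelocity.clm_comp {c : ℝ → E} {x v : E}
    (h : HasVelocity (E := E) c x (v : TangentSpace 𝓘(ℝ, E) x)) (L : E →L[ℝ] E') :
    HasVelocity (E := E') (fun τ => L (c τ)) (L x) (L v : E') := by
  have := h.comp L.contDiff.contMDiff.contMDiffAt
  rw [mfderiv_eq_fderiv, L.fderiv] at this
  exact this

/-- A straight line in the preferred chart at `x` works: in that chart, a tangent vector at `x` is
its own coordinate vector. -/
theorem exists_hasVelocity [IsManifold 𝓘(ℝ, E) ∞ X] (x : X) (v : TangentSpace 𝓘(ℝ, E) x) :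
    ∃ c : ℝ → X, HasVelocity c x v := by
  suffices H : ∀ w : E, ∃ c : ℝ → X, HasVelocity c x (w : TangentSpace 𝓘(ℝ, E) x) from H v
  intro v
  have h₀ := hasVelocity_line (extChartAt 𝓘(ℝ, E) x x) v
  have h₁ : ContMDiffAt 𝓘(ℝ, E) 𝓘(ℝ, E) ∞ (extChartAt 𝓘(ℝ, E) x).symm
      (extChartAt 𝓘(ℝ, E) x x) :=
    (contMDiffOn_extChartAt_symm x).contMDiffAt (extChartAt_target_mem_nhds x)
  have h₂ := h₀.comp h₁
  refine ⟨_, h₂.1.trans (extChartAt_to_inv (I := 𝓘(ℝ, E)) x), h₂.2.1, h₂.2.2.trans ?_⟩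
  have : IsManifold 𝓘(ℝ, E) 1 X := IsManifold.of_le (n := ∞) (by simp)
  -- The differential of the inverse chart at `x` is a coordinate change of the tangent bundle from
  -- a chart to itself, hence the identity.
  have h₃ := TangentBundle.symmL_trivializationAt (I := 𝓘(ℝ, E)) (mem_chart_source E x)
  rw [ModelWithCorners.range_eq_univ, mfderivWithin_univ] at h₃
  refine (congrArg (fun L : E →L[ℝ] E => L v) h₃).symm.trans ?_
  have h₄ := TangentBundle.symmL_trivializationAt_eq_core (I := 𝓘(ℝ, E)) (mem_chart_source E x)
  refine (congrArg (fun L : E →L[ℝ] E => L v) h₄).trans ?_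
  exact (tangentBundleCore 𝓘(ℝ, E) X).coordChange_self (achart E x) x (mem_chart_source E x) _

/-- The differential of a real-valued function. -/
def realDiff (y : X → ℝ) (x : X) : TangentSpace 𝓘(ℝ, E) x →L[ℝ] ℝ :=
  mfderiv 𝓘(ℝ, E) 𝓘(ℝ, ℝ) y x

theorem HasVelocity.realDiff {c : ℝ → X} {x : X} {v : TangentSpace 𝓘(ℝ, E) x}
    (h : HasVelocity c x v) {y : X → ℝ} (hy : ContMDiffAt 𝓘(ℝ, E) 𝓘(ℝ, ℝ) ∞ y x) :
    HasVelocity (E := ℝ) (y ∘ c) (y x) (realDiff y x v) :=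
  h.comp hy

end Velocity

/-! ### Lifting vectors and curves along submersions -/

section Submersion

variable {E : Type*} [NormedAddCommGroup E] [NormedSpace ℝ E]
  {U : Type*} [TopologicalSpace U] [ChartedSpace E U] [IsManifold 𝓘(ℝ, E) ∞ U]
  {E' : Type*} [NormedAddCommGroup E'] [NormedSpace ℝ E']
  {M : Type*} [TopologicalSpace M] [ChartedSpace E' M] [IsManifold 𝓘(ℝ, E') ∞ M]

/-- Differentiating the local section through `u₀` provides the preimage. -/
theorem Manifold.IsSubmersionAt.surjective_mfderiv {q : U → M} {u₀ : U}
    (hq : Manifold.IsSubmersionAt 𝓘(ℝ, E) 𝓘(ℝ, E') ∞ q u₀) (w : TangentSpace 𝓘(ℝ, E') (q u₀)) :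
    ∃ v : TangentSpace 𝓘(ℝ, E) u₀, mfderiv 𝓘(ℝ, E) 𝓘(ℝ, E') q u₀ v = w := by
  obtain ⟨σ, hσ, hqσ, hσq⟩ := hq.exists_sections
  have hσ₀ : σ (q u₀, u₀) = u₀ := hσq.self_of_nhds
  obtain ⟨c, hc⟩ := exists_hasVelocity (q u₀) w
  have hs : ContMDiffAt 𝓘(ℝ, E') 𝓘(ℝ, E) ∞ (fun m => σ (m, u₀)) (q u₀) :=
    hσ.comp (q u₀) (contMDiffAt_id.prodMk contMDiffAt_const)
  have h₁ := (hc.comp hs).cast hσ₀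
  refine ⟨_, (h₁.comp hq.contMDiffAt).unique hc ?_⟩
  have : Tendsto (fun τ => (c τ, u₀)) (𝓝 0) (𝓝 (q u₀, u₀)) :=
    hc.continuousAt.prodMk_nhds tendsto_const_nhds
  exact this.eventually hqσ

/-- Curves lift along submersions, with any prescribed admissible initial velocity. -/
theorem Manifold.IsSubmersionAt.exists_lift_curve {q : U → M} {u₀ : U}
    (hq : Manifold.IsSubmersionAt 𝓘(ℝ, E) 𝓘(ℝ, E') ∞ q u₀) (v : TangentSpace 𝓘(ℝ, E) u₀)
    {c : ℝ → M} (hc : HasVelocity c (q u₀) (mfderiv 𝓘(ℝ, E) 𝓘(ℝ, E') q u₀ v)) :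
    ∃ γ : ℝ → U, HasVelocity γ u₀ v ∧ ∀ᶠ τ in 𝓝 0, q (γ τ) = c τ := by
  obtain ⟨σ, hσ, hqσ, hσq⟩ := hq.exists_sections
  have hσ₀ : σ (q u₀, u₀) = u₀ := hσq.self_of_nhds
  obtain ⟨γ, hγ⟩ := exists_hasVelocity u₀ v
  have hqγ := hγ.comp hq.contMDiffAt
  have hlim : ∀ c : ℝ → M, HasVelocity c (q u₀) (mfderiv 𝓘(ℝ, E) 𝓘(ℝ, E') q u₀ v) →
      Tendsto (fun τ => (c τ, γ τ)) (𝓝 0) (𝓝 (q u₀, u₀)) := fun c hc =>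
    hc.continuousAt.prodMk_nhds hγ.continuousAt
  -- The velocity of `σ (c, γ)` depends only on the velocities of `c` and `γ`. It can therefore be
  -- computed with `q ∘ γ` in place of `c`, where the curve is `γ` itself.
  have key : ∀ c : ℝ → M, HasVelocity c (q u₀) (mfderiv 𝓘(ℝ, E) 𝓘(ℝ, E') q u₀ v) →
      ContMDiffAt 𝓘(ℝ, ℝ) 𝓘(ℝ, E) ∞ (fun τ => σ (c τ, γ τ)) 0 ∧
      (mfderiv 𝓘(ℝ, ℝ) 𝓘(ℝ, E) (fun τ => σ (c τ, γ τ)) 0 (1 : ℝ) : E) =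
      (mfderiv (𝓘(ℝ, E').prod 𝓘(ℝ, E)) 𝓘(ℝ, E) σ (q u₀, u₀) :
        E' × E →L[ℝ] E) ((mfderiv 𝓘(ℝ, E) 𝓘(ℝ, E') q u₀ v : E'), (v : E)) := by
    intro c hc
    have hσ' : ContMDiffAt (𝓘(ℝ, E').prod 𝓘(ℝ, E)) 𝓘(ℝ, E) ∞ σ (c 0, γ 0) := by
      rwa [hc.1, hγ.1]
    refine ⟨hσ'.comp (0 : ℝ) (hc.2.1.prodMk hγ.2.1), ?_⟩
    have h := (hσ'.mdifferentiableAt (by simp)).hasMFDerivAt.comp (0 : ℝ)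
      (hc.mdifferentiableAt.hasMFDerivAt.prodMk hγ.mdifferentiableAt.hasMFDerivAt)
    have h' := h.mfderiv
    refine (congrArg (fun L : ℝ →L[ℝ] E => L 1) h').trans ?_
    have h₁ := hc.2.2
    have h₂ := hγ.2.2
    have : ((mfderiv 𝓘(ℝ, ℝ) 𝓘(ℝ, E') c 0 (1 : ℝ) : E'), (mfderiv 𝓘(ℝ, ℝ) 𝓘(ℝ, E) γ 0 (1 : ℝ) : E))
        = ((mfderiv 𝓘(ℝ, E) 𝓘(ℝ, E') q u₀ v : E'), (v : E)) := Prod.ext h₁ h₂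
    have h₃ : (c 0, γ 0) = (q u₀, u₀) := Prod.ext hc.1 hγ.1
    exact congr (congrArg (fun p => ((mfderiv (𝓘(ℝ, E').prod 𝓘(ℝ, E)) 𝓘(ℝ, E) σ p :
      E' × E →L[ℝ] E) : E' × E → E)) h₃) this
  refine ⟨fun τ => σ (c τ, γ τ), ⟨by simp only [hc.1, hγ.1, hσ₀], (key c hc).1, ?_⟩, ?_⟩
  · rw [(key c hc).2, ← (key _ hqγ).2]
    have h₁ : HasVelocity (fun τ => σ ((q ∘ γ) τ, γ τ)) u₀ v := by
      refine hγ.congr ?_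
      filter_upwards [hγ.continuousAt.eventually hσq] with τ hτ using hτ
    exact h₁.2.2
  · exact (hlim c hc).eventually hqσ

end Submersion

section Product
variable {E₁ : Type*} [NormedAddCommGroup E₁] [NormedSpace ℝ E₁]
  {U₁ : Type*} [TopologicalSpace U₁] [ChartedSpace E₁ U₁] [IsManifold 𝓘(ℝ, E₁) ∞ U₁]
  {E₂ : Type*} [NormedAddCommGroup E₂] [NormedSpace ℝ E₂]
  {U₂ : Type*} [TopologicalSpace U₂] [ChartedSpace E₂ U₂] [IsManifold 𝓘(ℝ, E₂) ∞ U₂]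

/-- The vector field `Z₁ ⊕ Z₂` on a product. -/
theorem contMDiff_prod_section {Z₁ : (u : U₁) → TangentSpace 𝓘(ℝ, E₁) u}
    {Z₂ : (u : U₂) → TangentSpace 𝓘(ℝ, E₂) u} (h₁ : IsSmoothVF Z₁) (h₂ : IsSmoothVF Z₂) :
    ContMDiff (𝓘(ℝ, E₁).prod 𝓘(ℝ, E₂)) (𝓘(ℝ, E₁).prod 𝓘(ℝ, E₂)).tangent ∞
      (fun p : U₁ × U₂ => (⟨p, (Z₁ p.1, Z₂ p.2)⟩ :
        TangentBundle (𝓘(ℝ, E₁).prod 𝓘(ℝ, E₂)) (U₁ × U₂))) := by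
  have : IsManifold 𝓘(ℝ, E₁) 1 U₁ := IsManifold.of_le (n := ∞) (by simp)
  have : IsManifold 𝓘(ℝ, E₂) 1 U₂ := IsManifold.of_le (n := ∞) (by simp)
  exact (contMDiff_equivTangentBundleProd_symm (I := 𝓘(ℝ, E₁)) (M := U₁) (I' := 𝓘(ℝ, E₂))
    (M' := U₂)).comp ((h₁.comp contMDiff_fst).prodMk (h₂.comp contMDiff_snd))

end Product

/-! ### Submersions from surjectivity of the differential -/

/-- A local diffeomorphism obtained from the inverse function theorem, smooth with smooth inverse
on all of its source and target. -/
theorem exists_openPartialHomeomorph_of_fderiv_eq_id {E : Type*} [NormedAddCommGroup E]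
    [NormedSpace ℝ E] [CompleteSpace E] {g : E → E} {O : Set E} (hO : IsOpen O)
    (hg : ContDiffOn ℝ ∞ g O) {a : E} (ha : a ∈ O)
    (h : HasFDerivAt g (ContinuousLinearMap.id ℝ E) a) :
    ∃ Φ : OpenPartialHomeomorph E E, (∀ x, Φ x = g x) ∧ a ∈ Φ.source ∧ Φ.source ⊆ O ∧
      ContDiffOn ℝ ∞ Φ.symm Φ.target := by
  have hga : ContDiffAt ℝ ∞ g a := hg.contDiffAt (hO.mem_nhds ha)
  have h' : HasFDerivAt g ((ContinuousLinearEquiv.refl ℝ E : E ≃L[ℝ] E) : E →L[ℝ] E) a := h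
  let Φ₀ := hga.toOpenPartialHomeomorph g h' (by simp)
  have hΦ₀ : ∀ x, Φ₀ x = g x := fun x => rfl
  -- Restricting to the open set where the derivative is invertible makes the inverse smooth on the
  -- whole target, not only at the image of `a`.
  let S : Set E := O ∩ fderiv ℝ g ⁻¹' Set.range ((↑) : (E ≃L[ℝ] E) → (E →L[ℝ] E))
  have hS : IsOpen S :=
    (hg.continuousOn_fderiv_of_isOpen hO (by simp)).isOpen_inter_preimage hO
      ContinuousLinearEquiv.isOpen
  have haS : a ∈ S := ⟨ha, ContinuousLinearEquiv.refl ℝ E, h'.fderiv.symm⟩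
  refine ⟨Φ₀.restrOpen S hS, hΦ₀, ?_, ?_, ?_⟩
  · exact ⟨hga.mem_toOpenPartialHomeomorph_source h' (by simp), haS⟩
  · exact fun x hx => hx.2.1
  · intro y hy
    have hm := (Φ₀.restrOpen S hS).map_target hy
    obtain ⟨L, hL⟩ := hm.2.2
    have hgx : ContDiffAt ℝ ∞ g ((Φ₀.restrOpen S hS).symm y) :=
      hg.contDiffAt (hO.mem_nhds hm.2.1)
    refine ((Φ₀.restrOpen S hS).contDiffAt_symm hy (f₀' := L) ?_ hgx).contDiffWithinAt
    rw [hL]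
    exact (hgx.differentiableAt (by simp)).hasFDerivAt

/-- Pair `D` with a linear projection onto its kernel. Using a Euclidean space of the right
dimension instead of the kernel makes the complement independent of `D`. -/
theorem exists_equiv_prod_of_surjective {E E' : Type*} [NormedAddCommGroup E] [NormedSpace ℝ E]
    [FiniteDimensional ℝ E] [NormedAddCommGroup E'] [NormedSpace ℝ E'] [FiniteDimensional ℝ E']
    (D : E →L[ℝ] E') (hD : Function.Surjective D) :
    ∃ A : E ≃L[ℝ]
      E' × EuclideanSpace ℝ (Fin (Module.finrank ℝ E - Module.finrank ℝ E')),
      ∀ v, (A v).1 = D v := by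
  have hrank := D.toLinearMap.finrank_range_add_finrank_ker
  have hr : D.toLinearMap.range = ⊤ := LinearMap.range_eq_top.2 hD
  rw [hr, finrank_top] at hrank
  have hk : Module.finrank ℝ D.toLinearMap.ker =
      Module.finrank ℝ (EuclideanSpace ℝ (Fin (Module.finrank ℝ E - Module.finrank ℝ E'))) := by
    rw [finrank_euclideanSpace_fin]; omega
  let j := LinearEquiv.ofFinrankEq _ _ hk
  obtain ⟨p, hp⟩ := LinearMap.exists_leftInverse_of_injective D.toLinearMap.ker.subtype
    (Submodule.ker_subtype _)
  have hinj : Function.Injective (D.toLinearMap.prod (j.toLinearMap ∘ₗ p)) := by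
    rw [← LinearMap.ker_eq_bot, LinearMap.ker_eq_bot']
    intro v hv
    have h₁ : D v = 0 := congrArg Prod.fst hv
    have h₂ : j (p v) = 0 := congrArg Prod.snd hv
    have h₃ : p v = ⟨v, h₁⟩ := LinearMap.congr_fun hp ⟨v, h₁⟩
    rw [h₃] at h₂
    exact congrArg Subtype.val (j.map_eq_zero_iff.1 h₂)
  have hdim : Module.finrank ℝ E = Module.finrank ℝ
      (E' × EuclideanSpace ℝ (Fin (Module.finrank ℝ E - Module.finrank ℝ E'))) := by
    rw [Module.finrank_prod, finrank_euclideanSpace_fin]; omega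
  exact ⟨(LinearMap.linearEquivOfInjective _ hinj hdim).toContinuousLinearEquiv, fun v => rfl⟩

section

variable {E : Type*} [NormedAddCommGroup E] [NormedSpace ℝ E] [FiniteDimensional ℝ E]
  {U : Type*} [TopologicalSpace U] [ChartedSpace E U] [IsManifold 𝓘(ℝ, E) ∞ U]
  {E' : Type*} [NormedAddCommGroup E'] [NormedSpace ℝ E'] [FiniteDimensional ℝ E']
  {M : Type*} [TopologicalSpace M] [ChartedSpace E' M] [IsManifold 𝓘(ℝ, E') ∞ M]

/-- A smooth map whose differential is surjective at `x` is a submersion at `x`. -/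
theorem ContMDiff.isSubmersionAtOfComplement {f : U → M}
    (hf : ContMDiff 𝓘(ℝ, E) 𝓘(ℝ, E') ∞ f) (x : U)
    (hx : ∀ w : TangentSpace 𝓘(ℝ, E') (f x), ∃ v, mfderiv 𝓘(ℝ, E) 𝓘(ℝ, E') f x v = w) :
    Manifold.IsSubmersionAtOfComplement
      (EuclideanSpace ℝ (Fin (Module.finrank ℝ E - Module.finrank ℝ E')))
      𝓘(ℝ, E) 𝓘(ℝ, E') ∞ f x := by
  have : CompleteSpace E := FiniteDimensional.complete ℝ E
  set ζ := chartAt E x with hζ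
  set χ := chartAt E' (f x) with hχ
  set g : E → E' := χ ∘ f ∘ ζ.symm with hgdef
  let O : Set E := ζ.target ∩ ζ.symm ⁻¹' (f ⁻¹' χ.source)
  have hO : IsOpen O := ζ.isOpen_inter_preimage_symm (χ.open_source.preimage hf.continuous)
  have hxζ : x ∈ ζ.source := mem_chart_source E x
  have ha : ζ x ∈ O := ⟨ζ.map_source hxζ, by
    show f (ζ.symm (ζ x)) ∈ χ.source
    rw [ζ.left_inv hxζ]
    exact mem_chart_source E' (f x)⟩
  have hg : ContDiffOn ℝ ∞ g O := by
    rw [← contMDiffOn_iff_contDiffOn]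
    refine (contMDiffOn_chart (I := 𝓘(ℝ, E')) (x := f x)).comp
      (hf.comp_contMDiffOn
        ((contMDiffOn_chart_symm (I := 𝓘(ℝ, E)) (x := x)).mono fun y hy => hy.1)) fun y hy => hy.2
  have hgd : HasFDerivAt g (fderiv ℝ g (ζ x)) (ζ x) :=
    ((hg.contDiffAt (hO.mem_nhds ha)).differentiableAt (by simp)).hasFDerivAt
  have hD : ∀ v : E, fderiv ℝ g (ζ x) v = (mfderiv 𝓘(ℝ, E) 𝓘(ℝ, E') f x v : E') := by
    intro v
    have hfx : MDifferentiableAt 𝓘(ℝ, E) 𝓘(ℝ, E') f x := hf.contMDiffAt.mdifferentiableAt (by simp)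
    have : mfderiv 𝓘(ℝ, E) 𝓘(ℝ, E') f x = fderiv ℝ g (ζ x) := by
      rw [hfx.mfderiv, ModelWithCorners.range_eq_univ, fderivWithin_univ]
      rfl
    exact (congrArg (fun L : E →L[ℝ] E' => L v) this).symm
  obtain ⟨A, hA⟩ := exists_equiv_prod_of_surjective (fderiv ℝ g (ζ x)) fun w => by
    obtain ⟨v, hv⟩ := hx w
    exact ⟨v, (hD v).trans hv⟩
  -- In the coordinates `A`, this replaces the first component by `g` itself. As `(A v).1` is the
  -- derivative of `g`, the derivative of `G` at the point is the identity; and `g` is the first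
  -- projection in the coordinates `A ∘ G`.
  let G : E → E := fun v => A.symm (g v, (A v).2)
  have hG : ContDiffOn ℝ ∞ G O :=
    A.symm.contDiff.comp_contDiffOn
      (hg.prodMk (contDiff_snd.comp A.contDiff).contDiffOn)
  have hGd : HasFDerivAt G (ContinuousLinearMap.id ℝ E) (ζ x) := by
    have h₁ : HasFDerivAt (fun v => (A v).2)
        ((ContinuousLinearMap.snd ℝ _ _).comp (A : E →L[ℝ] _)) (ζ x) :=
      (hasFDerivAt_snd (𝕜 := ℝ)).comp (ζ x) A.hasFDerivAt
    have h₂ : HasFDerivAt G _ (ζ x) :=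
      (A.symm.hasFDerivAt (x := (g (ζ x), (A (ζ x)).2))).comp (ζ x) (hgd.prodMk h₁)
    convert h₂ using 1
    refine ContinuousLinearMap.ext fun v => ?_
    have h₃ : A v = (fderiv ℝ g (ζ x) v, (A v).2) := Prod.ext (hA v) rfl
    exact ((congrArg A.symm h₃).symm.trans (A.symm_apply_apply v)).symm
  obtain ⟨Φ, hΦ, haΦ, hΦO, hΦs⟩ := exists_openPartialHomeomorph_of_fderiv_eq_id hO hG ha hGd
  have hcf : ContMDiffOn 𝓘(ℝ, E) 𝓘(ℝ, E) ∞ Φ Φ.source :=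
    ((hG.mono hΦO).congr fun y _ => hΦ y).contMDiffOn
  have hcs : ContMDiffOn 𝓘(ℝ, E) 𝓘(ℝ, E) ∞ Φ.symm Φ.target := hΦs.contMDiffOn
  refine Manifold.IsSubmersionAtOfComplement.mk_of_charts A (ζ.trans Φ) χ ?_
    (mem_chart_source E' (f x)) ?_ (IsManifold.chart_mem_maximalAtlas _) ?_ ?_
  · simpa [hxζ] using haΦ
  · apply OpenPartialHomeomorph.mem_maximalAtlas_of_contMDiffOn
    · refine hcf.comp ((contMDiffOn_chart (I := 𝓘(ℝ, E)) (x := x)).mono ?_) ?_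
      · intro y hy
        simp only [OpenPartialHomeomorph.trans_source] at hy
        exact hy.1
      · intro y hy
        simp only [OpenPartialHomeomorph.trans_source] at hy
        exact hy.2
    · refine (contMDiffOn_chart_symm (I := 𝓘(ℝ, E)) (x := x)).comp (hcs.mono ?_) ?_
      · intro y hy
        simp only [OpenPartialHomeomorph.trans_target] at hy
        exact hy.1
      · intro y hy
        simp only [OpenPartialHomeomorph.trans_target] at hy
        exact hy.2
  · intro y hy
    simp only [OpenPartialHomeomorph.trans_source] at hy
    have h := (hΦO hy.2).2
    simp only [Set.mem_preimage, ζ.left_inv hy.1] at h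
    exact h
  · intro y hy
    simp only [OpenPartialHomeomorph.extend, mfld_simps] at hy
    have h₁ : Φ (Φ.symm y) = y := Φ.right_inv hy.1
    rw [hΦ] at h₁
    have h₂ : A (G (Φ.symm y)) = (g (Φ.symm y), (A (Φ.symm y)).2) := A.apply_symm_apply _
    rw [h₁] at h₂
    simp [OpenPartialHomeomorph.extend, h₂, hgdef]

theorem ContMDiff.isSubmersion {f : U → M} (hf : ContMDiff 𝓘(ℝ, E) 𝓘(ℝ, E') ∞ f)
    (h : ∀ x, ∀ w : TangentSpace 𝓘(ℝ, E') (f x), ∃ v, mfderiv 𝓘(ℝ, E) 𝓘(ℝ, E') f x v = w) :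
    Manifold.IsSubmersion 𝓘(ℝ, E) 𝓘(ℝ, E') ∞ f :=
  Manifold.IsSubmersionOfComplement.isSubmersion fun x =>
    hf.isSubmersionAtOfComplement x (h x)

end

/-! ### Local frames of vertical vector fields -/

section Frames

variable {E : Type*} [NormedAddCommGroup E] [NormedSpace ℝ E]
  {U : Type*} [TopologicalSpace U] [ChartedSpace E U] [IsManifold 𝓘(ℝ, E) ∞ U]
  {E' : Type*} [NormedAddCommGroup E'] [NormedSpace ℝ E']
  {M : Type*} [TopologicalSpace M] [ChartedSpace E' M]

/-- This is extension by zero: off the support of `b` the product vanishes on a neighbourhood. -/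
theorem contMDiff_smul_section_of_tsupport {b : U → ℝ} (hb : ContMDiff 𝓘(ℝ, E) 𝓘(ℝ, ℝ) ∞ b)
    {Y : (u : U) → TangentSpace 𝓘(ℝ, E) u}
    (hY : ∀ u ∈ tsupport b, ContMDiffAt 𝓘(ℝ, E) 𝓘(ℝ, E).tangent ∞
      (fun u => (⟨u, Y u⟩ : TangentBundle 𝓘(ℝ, E) U)) u) :
    IsSmoothVF (fun u => b u • Y u) := by
  have : IsManifold 𝓘(ℝ, E) 1 U := IsManifold.of_le (n := ∞) (by simp)
  intro u
  by_cases hu : u ∈ tsupport b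
  · exact hb.contMDiffAt.smul_section (hY u hu)
  · have h₀ : ContMDiffAt 𝓘(ℝ, E) 𝓘(ℝ, E).tangent ∞
        (fun u => (⟨u, 0⟩ : TangentBundle 𝓘(ℝ, E) U)) u :=
      Bundle.contMDiff_zeroSection ℝ (TangentSpace 𝓘(ℝ, E) : U → Type _) u
    refine h₀.congr_of_eventuallyEq ?_
    filter_upwards [(isClosed_tsupport b).isOpen_compl.mem_nhds hu] with x hx
    rw [image_eq_zero_of_notMem_tsupport hx, zero_smul]

variable [FiniteDimensional ℝ E] [T2Space U]

theorem exists_isSmoothCc_eventually_eq_one {O : Set U} (hO : IsOpen O) {u₀ : U} (hu : u₀ ∈ O) :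
    ∃ b : U → ℝ, IsSmoothCc E b ∧ tsupport b ⊆ O ∧ ∀ᶠ u in 𝓝 u₀, b u = 1 := by
  obtain ⟨b, -, hb⟩ := (SmoothBumpFunction.nhds_basis_tsupport (I := 𝓘(ℝ, E)) u₀).mem_iff.1
    (hO.mem_nhds hu)
  exact ⟨b, ⟨b.contMDiff, b.hasCompactSupport⟩, hb, b.eventuallyEq_one⟩

/-- Near any point, the vertical bundle of a submersion is spanned by compactly supported
vertical vector fields, with coefficients that are differentials of smooth functions. -/
theorem Manifold.IsSubmersionAt.exists_vertical_frame {q : U → M} {u₀ : U}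
    (hq : Manifold.IsSubmersionAt 𝓘(ℝ, E) 𝓘(ℝ, E') ∞ q u₀) (hqs : ContMDiff 𝓘(ℝ, E) 𝓘(ℝ, E') ∞ q) :
    ∃ (n : ℕ) (Y : Fin n → (u : U) → TangentSpace 𝓘(ℝ, E) u) (y : Fin n → U → ℝ),
      (∀ j, Y j ∈ verticalVF (E' := E') q) ∧ (∀ j, ContMDiff 𝓘(ℝ, E) 𝓘(ℝ, ℝ) ∞ (y j)) ∧
      ∀ᶠ u in 𝓝 u₀, ∀ v : TangentSpace 𝓘(ℝ, E) u, mfderiv 𝓘(ℝ, E) 𝓘(ℝ, E') q u v = 0 →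
        v = ∑ j, realDiff (y j) u v • Y j u := by
  obtain ⟨F, _, _, hq⟩ := hq
  obtain ⟨ψ, χ, A, hψ, hχ, hu₀, hs, hqψ⟩ := hq.exists_charts
  obtain ⟨b, hb, hbψ, hb₁⟩ :=
    exists_isSmoothCc_eventually_eq_one (E := E) ψ.open_source hu₀
  let B := Module.finBasis ℝ E
  -- The projection of the model space onto the vertical directions. Applied to a basis of all of
  -- `E`, it gives a spanning family of the vertical space, in general not a basis. Since `π` fixes
  -- vertical vectors, their coordinates in that basis still serve as coefficients.
  let π : E →L[ℝ] E := (A.symm : E' × F →L[ℝ] E).comp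
    (((0 : E' →L[ℝ] E').prodMap (ContinuousLinearMap.id ℝ F)).comp (A : E →L[ℝ] E' × F))
  have hπ : ∀ v : E, (A (π v)).1 = 0 := fun v => by simp [π]
  have hπ' : ∀ v : E, (A v).1 = 0 → π v = v := fun v hv => by
    have : ((0 : E'), (A v).2) = A v := Prod.ext hv.symm rfl
    exact (congrArg A.symm this).trans (A.symm_apply_apply v)
  let D : U → E →L[ℝ] E := fun u => mfderiv 𝓘(ℝ, E) 𝓘(ℝ, E) ψ.symm (ψ u)
  have hψs : ∀ u ∈ ψ.source, ContMDiffAt 𝓘(ℝ, E) 𝓘(ℝ, E) ∞ ψ.symm (ψ u) := fun u hu =>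
    contMDiffAt_symm_of_mem_maximalAtlas hψ (ψ.map_source hu)
  have hψc : ∀ u ∈ ψ.source, ContMDiffAt 𝓘(ℝ, E) 𝓘(ℝ, E) ∞ ψ u := fun u hu =>
    contMDiffAt_of_mem_maximalAtlas hψ hu
  have hDs : ∀ c : E, ∀ u ∈ ψ.source, ContMDiffAt 𝓘(ℝ, E) 𝓘(ℝ, E).tangent ∞
      (fun u => (⟨u, D u c⟩ : TangentBundle 𝓘(ℝ, E) U)) u := by
    intro c u hu
    have h₁ : ContMDiffAt 𝓘(ℝ, E) 𝓘(ℝ, E).tangent ∞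
        (fun e : E => (⟨e, c⟩ : TangentBundle 𝓘(ℝ, E) E)) (ψ u) :=
      contMDiffAt_vectorSpace_iff_contDiffAt.2 contDiffAt_const
    have h₂ := ((hψs u hu).mfderiv_section h₁).comp u (hψc u hu)
    refine h₂.congr_of_eventuallyEq ?_
    filter_upwards [ψ.open_source.mem_nhds hu] with x hx
    have aux : ∀ (a a' : U), a = a' → ∀ w : E,
        (⟨a, w⟩ : TangentBundle 𝓘(ℝ, E) U) = ⟨a', w⟩ := by rintro a _ rfl w; rfl
    exact (aux _ _ (ψ.left_inv hx) _).symm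
  have hDψ : ∀ u ∈ ψ.source, ∀ v : E, D u (mfderiv 𝓘(ℝ, E) 𝓘(ℝ, E) ψ u v : E) = v := by
    intro u hu v
    obtain ⟨γ, hγ⟩ := exists_hasVelocity (E := E) u v
    have h := ((hγ.comp (hψc u hu)).comp (hψs u hu)).cast (ψ.left_inv hu)
    refine h.unique hγ ?_
    filter_upwards [hγ.continuousAt.eventually (ψ.open_source.mem_nhds hu)] with τ hτ
    exact ψ.left_inv hτ
  have hDq : ∀ u ∈ ψ.source, ∀ c : E, (A c).1 = 0 →
      mfderiv 𝓘(ℝ, E) 𝓘(ℝ, E') q u (D u c : E) = 0 := by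
    intro u hu c hc
    have hγ := (((hasVelocity_line (ψ u) c).comp (hψs u hu)).cast (ψ.left_inv hu)).comp
      hqs.contMDiffAt
    refine hγ.unique (HasVelocity.const (q u)) ?_
    filter_upwards [(hasVelocity_line (ψ u) c).continuousAt.eventually
      (ψ.open_target.mem_nhds (ψ.map_source hu))] with τ hτ
    refine χ.injOn (hs _ (ψ.map_target hτ)) (hs _ hu) ?_
    rw [← hqψ _ (ψ.map_target hτ), ← hqψ _ hu, ψ.right_inv hτ]
    simp [hc]
  have hyc : ∀ j, ContMDiff 𝓘(ℝ, E) 𝓘(ℝ, ℝ) ∞ fun u => b u * B.repr (ψ u) j := by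
    intro j
    have hc : ContDiff ℝ ∞ fun e : E => B.repr e j :=
      (LinearMap.toContinuousLinearMap (B.coord j)).contDiff
    refine contMDiff_of_tsupport fun u hu => ?_
    have hu' : u ∈ ψ.source := hbψ (tsupport_mul_subset_left hu)
    exact hb.1.contMDiffAt.mul (hc.contMDiff.contMDiffAt.comp u (hψc u hu'))
  refine ⟨_, fun j u => b u • (D u (π (B j)) : E), fun j u => b u * B.repr (ψ u) j, ?_, ?_, ?_⟩
  · refine fun j => ⟨contMDiff_smul_section_of_tsupport hb.1 fun u hu => hDs _ u (hbψ hu),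
      ⟨tsupport b, hb.2, fun u hu => ?_⟩, fun u => ?_⟩
    · show b u • (D u (π (B j)) : E) = 0
      rw [image_eq_zero_of_notMem_tsupport hu, zero_smul]
    · by_cases hu : u ∈ tsupport b
      · exact ((mfderiv 𝓘(ℝ, E) 𝓘(ℝ, E') q u).map_smul (b u) _).trans
          (by rw [hDq u (hbψ hu) _ (hπ _), smul_zero])
      · exact ((mfderiv 𝓘(ℝ, E) 𝓘(ℝ, E') q u).map_smul (b u) _).trans
          (by rw [image_eq_zero_of_notMem_tsupport hu, zero_smul])
  · exact hyc
  -- The cut-off must equal `1` near `u`, not just at `u`, for the differential of the cut-off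
  -- coordinate to be that of the coordinate.
  · filter_upwards [hb₁.eventually_nhds, ψ.open_source.mem_nhds hu₀] with u hbu hu v hv
    have hAv : (A (mfderiv 𝓘(ℝ, E) 𝓘(ℝ, E) ψ u v : E)).1 = 0 := by
      obtain ⟨γ, hγ⟩ := exists_hasVelocity u v
      have h₁ := (hγ.comp (hψc u hu)).clm_comp
        ((ContinuousLinearMap.fst ℝ E' F).comp (A : E →L[ℝ] E' × F))
      have hχ' : ContMDiffAt 𝓘(ℝ, E') 𝓘(ℝ, E') ∞ χ (q u) :=
        contMDiffAt_of_mem_maximalAtlas hχ (hs _ hu)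
      have h₂ := (((hγ.comp hqs.contMDiffAt).comp hχ').cast (hqψ u hu).symm)
      rw [hv] at h₂
      refine (h₁.unique h₂ ?_).trans (map_zero (mfderiv 𝓘(ℝ, E') 𝓘(ℝ, E') χ (q u)))
      filter_upwards [hγ.continuousAt.eventually (ψ.open_source.mem_nhds hu)] with τ hτ
      exact hqψ _ hτ
    have hcoord : ∀ j, realDiff (fun u => b u * B.repr (ψ u) j) u v =
        B.repr (mfderiv 𝓘(ℝ, E) 𝓘(ℝ, E) ψ u v : E) j := by
      intro j
      obtain ⟨γ, hγ⟩ := exists_hasVelocity u v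
      let L := LinearMap.toContinuousLinearMap (B.coord j)
      have h₁ := (hγ.comp (hψc u hu)).clm_comp L
      have h₂ := (hγ.realDiff (hyc j u)).cast
        (show b u * B.repr (ψ u) j = L (ψ u) by rw [hbu.self_of_nhds, one_mul]; rfl)
      refine h₂.unique h₁ ?_
      filter_upwards [hγ.continuousAt.eventually hbu] with τ hτ
      show b (γ τ) * _ = _
      rw [hτ, one_mul]
      rfl
    have hbu' : b u = 1 := hbu.self_of_nhds
    simp only [hcoord, hbu', one_smul]
    have h₁ : ∑ j, B.repr (mfderiv 𝓘(ℝ, E) 𝓘(ℝ, E) ψ u v : E) j • D u (π (B j)) = v := by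
      have := hDψ u hu v
      rw [← hπ' _ hAv] at this
      conv_lhs at this => rw [← B.sum_repr (mfderiv 𝓘(ℝ, E) 𝓘(ℝ, E) ψ u v : E)]
      simpa [map_sum] using this
    exact h₁.symm

end Frames

/-! ### The pullback module is determined locally -/

section Pullback

variable {E : Type*} [NormedAddCommGroup E] [NormedSpace ℝ E]
  {X : Type*} [TopologicalSpace X] [ChartedSpace E X]
  {E' : Type*} [NormedAddCommGroup E'] [NormedSpace ℝ E']
  {Y : Type*} [TopologicalSpace Y] [ChartedSpace E' Y] [IsManifold 𝓘(ℝ, E) ∞ X]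

/-- Membership in a pullback, in terms of explicit finite sums. -/
theorem mem_pullbackVF_iff {φ : X → Y} {𝓕 : Set ((y : Y) → TangentSpace 𝓘(ℝ, E') y)}
    {Z : (x : X) → TangentSpace 𝓘(ℝ, E) x} :
    Z ∈ pullbackVF φ 𝓕 ↔ IsSmoothVF Z ∧ IsCompactlySupportedVF Z ∧
      ∃ (n : ℕ) (f : Fin n → X → ℝ) (V : Fin n → (y : Y) → TangentSpace 𝓘(ℝ, E') y),
        (∀ i, IsSmoothCc E (f i)) ∧ (∀ i, V i ∈ 𝓕) ∧
        ∀ p, mfderiv 𝓘(ℝ, E) 𝓘(ℝ, E') φ p (Z p) = ∑ i, f i p • V i (φ p) := by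
  refine and_congr Iff.rfl (and_congr Iff.rfl ?_)
  rw [Submodule.mem_span_set']
  constructor
  · rintro ⟨n, c, g, h⟩
    choose f hf V hV hg using fun i => (g i).2
    refine ⟨n, fun i p => c i * f i p, V, fun i => ⟨?_, ?_⟩, hV, fun p => ?_⟩
    · exact contMDiff_const.mul (hf i).1
    · exact (hf i).2.mul_left
    · have := congrFun h p
      refine this.symm.trans ?_
      rw [Finset.sum_apply]
      refine Finset.sum_congr rfl fun i _ => ?_
      rw [Pi.smul_apply, hg i, smul_smul]
  · rintro ⟨n, f, V, hf, hV, h⟩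
    refine ⟨n, fun _ => 1, fun i => ⟨_, f i, hf i, V i, hV i, rfl⟩, funext fun p => ?_⟩
    rw [h p, Finset.sum_apply]
    refine Finset.sum_congr rfl fun i _ => ?_
    rw [one_smul]

/-- Membership in a pullback is a local condition. -/
theorem mem_pullbackVF_of_local [FiniteDimensional ℝ E] [T2Space X] [SecondCountableTopology X]
    {φ : X → Y} {𝓕 : Set ((y : Y) → TangentSpace 𝓘(ℝ, E') y)}
    {Z : (x : X) → TangentSpace 𝓘(ℝ, E) x} (hZ : IsSmoothVF Z) (hZc : IsCompactlySupportedVF Z)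
    (h : ∀ x : X, ∃ (ι : Type) (_ : Fintype ι) (f : ι → X → ℝ) (V : ι → (y : Y) → TangentSpace 𝓘(ℝ, E') y),
        (∀ i, ContMDiff 𝓘(ℝ, E) 𝓘(ℝ, ℝ) ∞ (f i)) ∧ (∀ i, V i ∈ 𝓕) ∧
        ∀ᶠ p in 𝓝 x, mfderiv 𝓘(ℝ, E) 𝓘(ℝ, E') φ p (Z p) = ∑ i, f i p • V i (φ p)) :
    Z ∈ pullbackVF φ 𝓕 := by
  have : LocallyCompactSpace X := ChartedSpace.locallyCompactSpace E X
  have : SigmaCompactSpace X := inferInstance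
  refine ⟨hZ, hZc, ?_⟩
  obtain ⟨K, hK, hZK⟩ := hZc
  choose ι _ f V hf hV hfV using h
  choose O hOs hO hxO using fun x => mem_nhds_iff.1 (hfV x)
  obtain ⟨ρ, hρ⟩ := SmoothPartitionOfUnity.exists_isSubordinate 𝓘(ℝ, E) hK.isClosed O hO
    fun x _ => Set.mem_iUnion.2 ⟨x, hxO x⟩
  -- The functions of the partition of unity need not have compact support, so they are multiplied
  -- by a cut-off `g` equal to `1` on the set `K` carrying `Z`.
  obtain ⟨L, hL, hKL⟩ := exists_compact_superset hK
  obtain ⟨g, hg₁, hg₀, -⟩ := exists_contMDiffMap_one_nhds_of_subset_interior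
    𝓘(ℝ, E) (n := (⊤ : ℕ∞)) hK.isClosed hKL
  have hgc : HasCompactSupport g := HasCompactSupport.intro hL hg₀
  have hfin := ρ.locallyFinite.finite_nonempty_inter_compact hK
  have hsum : (fun p => mfderiv 𝓘(ℝ, E) 𝓘(ℝ, E') φ p (Z p)) =
      ∑ x ∈ hfin.toFinset, ∑ i, fun p => (g p * ρ x p * f x i p) • V x i (φ p) := by
    funext p
    -- The local expression for `x` is only valid on `O x`, but outside `O x` the factor `ρ x`
    -- vanishes.
    have hterm : ∀ x, ∑ i, (g p * ρ x p * f x i p) • V x i (φ p) =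
        (g p * ρ x p) • mfderiv 𝓘(ℝ, E) 𝓘(ℝ, E') φ p (Z p) := by
      intro x
      by_cases hp : p ∈ O x
      · rw [show mfderiv 𝓘(ℝ, E) 𝓘(ℝ, E') φ p (Z p) = _ from hOs x hp, Finset.smul_sum]
        exact Finset.sum_congr rfl fun i _ => mul_smul _ _ _
      · have : ρ x p = 0 := image_eq_zero_of_notMem_tsupport fun hx => hp (hρ x hx)
        simp [this]
    simp only [Finset.sum_apply, hterm]
    by_cases hp : p ∈ K
    · have hg1 : g p = 1 := hg₁.self_of_nhdsSet p hp
      rw [← Finset.sum_smul]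
      have h1 : ∑ x ∈ hfin.toFinset, g p * ρ x p = 1 := by
        rw [← ρ.sum_eq_one hp, finsum_eq_sum_of_support_subset _ (s := hfin.toFinset)]
        · simp [hg1]
        · intro x hx
          simp only [Set.Finite.coe_toFinset, Set.mem_ofPred_eq]
          exact ⟨p, hx, hp⟩
      rw [h1, one_smul]
    · rw [hZK p hp, map_zero]
      simp
  rw [hsum]
  refine Submodule.sum_mem _ fun x _ => Submodule.sum_mem _ fun i _ => Submodule.subset_span
    ⟨_, ⟨(g.contMDiff.mul (ρ x).contMDiff).mul (hf x i), ?_⟩, V x i, hV x i, rfl⟩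
  exact (hgc.mul_right).mul_right

end Pullback

/-! ### Invariant vector fields and the differential of the multiplication -/

namespace LieGrpd

variable {EM EG : Type*} [NormedAddCommGroup EM] [NormedSpace ℝ EM]
  [NormedAddCommGroup EG] [NormedSpace ℝ EG]
  {M G : Type*} [TopologicalSpace M] [ChartedSpace EM M] [IsManifold 𝓘(ℝ, EM) ∞ M]
  [TopologicalSpace G] [ChartedSpace EG G] [IsManifold 𝓘(ℝ, EG) ∞ G]
  (𝒢 : LieGrpd EM EG M G)

section Algebra

variable {𝒢}

theorem eq_inv_of_mul_eq_one {g h : G} (hgh : 𝒢.src g = 𝒢.tgt h)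
    (h₁ : 𝒢.mul g h = 𝒢.one (𝒢.tgt g)) : h = 𝒢.inv g := by
  have h₂ := 𝒢.mul_assoc (𝒢.inv g) g h (𝒢.src_inv g) hgh
  rw [𝒢.inv_mul, hgh, 𝒢.one_mul, h₁, ← 𝒢.src_inv, 𝒢.mul_one] at h₂
  exact h₂

theorem inv_inv (g : G) : 𝒢.inv (𝒢.inv g) = g :=
  (eq_inv_of_mul_eq_one (𝒢.src_inv g) (by rw [𝒢.inv_mul, 𝒢.tgt_inv])).symm

theorem inv_mul_cancel_left {g h : G} (hgh : 𝒢.src g = 𝒢.tgt h) :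
    𝒢.mul (𝒢.inv g) (𝒢.mul g h) = h := by
  rw [← 𝒢.mul_assoc _ _ _ (𝒢.src_inv g) hgh, 𝒢.inv_mul, hgh, 𝒢.one_mul]

theorem mul_inv_rev {g h : G} (hgh : 𝒢.src g = 𝒢.tgt h) :
    𝒢.inv (𝒢.mul g h) = 𝒢.mul (𝒢.inv h) (𝒢.inv g) := by
  have h₁ : 𝒢.src (𝒢.inv h) = 𝒢.tgt (𝒢.inv g) := by rw [𝒢.src_inv, 𝒢.tgt_inv, hgh]
  refine (eq_inv_of_mul_eq_one ?_ ?_).symm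
  · rw [𝒢.src_mul _ _ hgh, 𝒢.tgt_mul _ _ h₁, 𝒢.tgt_inv]
  · rw [← 𝒢.mul_assoc _ _ _ (by rw [𝒢.src_mul _ _ hgh, 𝒢.tgt_inv]) h₁,
      𝒢.mul_assoc _ _ _ hgh (𝒢.tgt_inv h).symm, 𝒢.mul_inv, ← hgh, 𝒢.mul_one, 𝒢.mul_inv,
      𝒢.tgt_mul _ _ hgh]

end Algebra

/-- The differential of the multiplication at `(g, h)`, defined on vectors tangent to the
composable pairs. -/
def dmul (g h : G) : EG × EG →L[ℝ] EG :=
  mfderivWithin (𝓘(ℝ, EG).prod 𝓘(ℝ, EG)) 𝓘(ℝ, EG) (fun p : G × G => 𝒢.mul p.1 p.2)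
    {p | 𝒢.src p.1 = 𝒢.tgt p.2} (g, h)

variable {𝒢}

theorem contMDiff_src : ContMDiff 𝓘(ℝ, EG) 𝓘(ℝ, EM) ∞ 𝒢.src := 𝒢.src_submersion.contMDiff

theorem contMDiff_tgt : ContMDiff 𝓘(ℝ, EG) 𝓘(ℝ, EM) ∞ 𝒢.tgt := 𝒢.tgt_submersion.contMDiff

/-- A derivative within the composable pairs is only significant on tangent directions of that set.
Along a curve of composable pairs the chain rule applies, and there `dmul` has its geometric
meaning. -/
theorem hasVelocity_mul {c₁ c₂ : ℝ → G} {g h : G} {v w : EG} (h₁ : HasVelocity (E := EG) c₁ g v)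
    (h₂ : HasVelocity (E := EG) c₂ h w) (hc : ∀ᶠ τ in 𝓝 0, 𝒢.src (c₁ τ) = 𝒢.tgt (c₂ τ)) :
    HasVelocity (E := EG) (fun τ => 𝒢.mul (c₁ τ) (c₂ τ)) (𝒢.mul g h) (𝒢.dmul g h (v, w)) := by
  obtain ⟨rfl, hs₁, rfl⟩ := h₁
  obtain ⟨rfl, hs₂, rfl⟩ := h₂
  have hm := 𝒢.mul_smooth (c₁ 0, c₂ 0) hc.self_of_nhds
  refine ⟨rfl, ?_, ?_⟩
  · exact (ContMDiffWithinAt.comp (t := {p : G × G | 𝒢.src p.1 = 𝒢.tgt p.2}) (0 : ℝ) hm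
      (hs₁.prodMk hs₂).contMDiffWithinAt
      (s := {τ | 𝒢.src (c₁ τ) = 𝒢.tgt (c₂ τ)}) (fun _ h => h)).contMDiffAt hc
  · have h₃ := (hm.mdifferentiableWithinAt (by simp)).hasMFDerivWithinAt
    have h₄ := (hs₁.mdifferentiableAt (by simp)).hasMFDerivAt.prodMk
      (hs₂.mdifferentiableAt (by simp)).hasMFDerivAt
    have h₅ := (HasMFDerivWithinAt.comp (f := fun τ => (c₁ τ, c₂ τ)) (0 : ℝ) h₃
      (h₄.hasMFDerivWithinAt (s := {τ | 𝒢.src (c₁ τ) = 𝒢.tgt (c₂ τ)}))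
      (fun _ h => h)).hasMFDerivAt hc
    exact congrArg (fun L : ℝ →L[ℝ] EG => L 1) h₅.mfderiv

theorem dmul_eq_mfderiv {E : Type*} [NormedAddCommGroup E] [NormedSpace ℝ E]
    {N : Type*} [TopologicalSpace N] [ChartedSpace E N] [IsManifold 𝓘(ℝ, E) ∞ N]
    {f₁ f₂ : N → G} (h₁ : ContMDiff 𝓘(ℝ, E) 𝓘(ℝ, EG) ∞ f₁) (h₂ : ContMDiff 𝓘(ℝ, E) 𝓘(ℝ, EG) ∞ f₂)
    (hf : ∀ p, 𝒢.src (f₁ p) = 𝒢.tgt (f₂ p)) (p : N) (v : TangentSpace 𝓘(ℝ, E) p) :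
    (mfderiv 𝓘(ℝ, E) 𝓘(ℝ, EG) (fun p => 𝒢.mul (f₁ p) (f₂ p)) p v : EG) =
      𝒢.dmul (f₁ p) (f₂ p) ((mfderiv 𝓘(ℝ, E) 𝓘(ℝ, EG) f₁ p v : EG),
        (mfderiv 𝓘(ℝ, E) 𝓘(ℝ, EG) f₂ p v : EG)) := by
  obtain ⟨c, hc⟩ := exists_hasVelocity p v
  have hm : ContMDiff 𝓘(ℝ, E) 𝓘(ℝ, EG) ∞ (fun p => 𝒢.mul (f₁ p) (f₂ p)) :=
    𝒢.mul_smooth.comp_contMDiff (h₁.prodMk h₂) hf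
  exact (hc.comp hm.contMDiffAt).unique (hasVelocity_mul (hc.comp h₁.contMDiffAt)
    (hc.comp h₂.contMDiffAt) (Eventually.of_forall fun τ => hf _)) EventuallyEq.rfl

variable {α : (x : M) → TangentSpace 𝓘(ℝ, EG) (𝒢.one x)}

/-- Elements of the Lie algebroid are velocities of curves in source fibres. -/
theorem exists_curve_src_fiber
    (hα : ∀ x, mfderiv 𝓘(ℝ, EG) 𝓘(ℝ, EM) 𝒢.src (𝒢.one x) (α x) = 0) (x : M) :
    ∃ γ : ℝ → G, HasVelocity γ (𝒢.one x) (α x) ∧ ∀ᶠ τ in 𝓝 0, 𝒢.src (γ τ) = x := by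
  have h₀ := HasVelocity.const (E := EM) (𝒢.src (𝒢.one x))
  rw [← hα x] at h₀
  obtain ⟨γ, h₁, h₂⟩ := (𝒢.src_submersion.isSubmersionAt (𝒢.one x)).exists_lift_curve (α x) h₀
  exact ⟨γ, h₁, h₂.mono fun τ h => h.trans (𝒢.src_one x)⟩

/-- Realises the right-invariant field by right translates of one curve in a source fibre, so that
groupoid identities can be differentiated. -/
theorem hasVelocity_mul_right {x : M} {γ : ℝ → G} (h₁ : HasVelocity γ (𝒢.one x) (α x))
    (h₂ : ∀ᶠ τ in 𝓝 0, 𝒢.src (γ τ) = x) {g : G} (hg : 𝒢.tgt g = x) :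
    HasVelocity (fun τ => 𝒢.mul (γ τ) g) g (𝒢.rightInvVF α g) := by
  subst hg
  have hs : ContMDiffWithinAt 𝓘(ℝ, EG) 𝓘(ℝ, EG) ∞ (fun h => 𝒢.mul h g)
      {h | 𝒢.src h = 𝒢.tgt g} (𝒢.one (𝒢.tgt g)) :=
    (𝒢.mul_smooth (𝒢.one (𝒢.tgt g), g) (𝒢.src_one _)).comp (𝒢.one (𝒢.tgt g))
      (contMDiffWithinAt_id.prodMk contMDiffWithinAt_const) fun h hh => hh
  exact (h₁.comp_within hs h₂).cast (𝒢.one_mul g)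

/-- Invert the right translate of `γ` by `g⁻¹`: `(γ g⁻¹)⁻¹ = g γ⁻¹`. The minus sign is the one in
the definition of the left-invariant field. -/
theorem hasVelocity_mul_left {x : M} {γ : ℝ → G} (h₁ : HasVelocity γ (𝒢.one x) (α x))
    (h₂ : ∀ᶠ τ in 𝓝 0, 𝒢.src (γ τ) = x) {g : G} (hg : 𝒢.src g = x) :
    HasVelocity (fun τ => 𝒢.mul g (𝒢.inv (γ τ))) g (-𝒢.leftInvVF α g) := by
  have h₃ := ((hasVelocity_mul_right h₁ h₂ ((𝒢.tgt_inv g).trans hg)).comp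
    (f := 𝒢.inv) 𝒢.inv_smooth.contMDiffAt).cast (inv_inv g)
  have h₄ : -𝒢.leftInvVF α g = (mfderiv 𝓘(ℝ, EG) 𝓘(ℝ, EG) 𝒢.inv (𝒢.inv g)
      (𝒢.rightInvVF α (𝒢.inv g)) : EG) := neg_neg _
  rw [h₄]
  refine h₃.congr ?_
  filter_upwards [h₂] with τ hτ
  show _ = 𝒢.inv (𝒢.mul (γ τ) (𝒢.inv g))
  rw [mul_inv_rev (by rw [hτ, 𝒢.tgt_inv, hg]), inv_inv]

section

variable (hα : ∀ x, mfderiv 𝓘(ℝ, EG) 𝓘(ℝ, EM) 𝒢.src (𝒢.one x) (α x) = 0)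

include hα

/-- The curve `γ g` stays in the source fibre of `g`. -/
theorem mfderiv_src_rightInvVF (g : G) :
    mfderiv 𝓘(ℝ, EG) 𝓘(ℝ, EM) 𝒢.src g (𝒢.rightInvVF α g) = 0 := by
  obtain ⟨γ, h₁, h₂⟩ := exists_curve_src_fiber hα (𝒢.tgt g)
  refine ((hasVelocity_mul_right h₁ h₂ rfl).comp contMDiff_src.contMDiffAt).unique
    (HasVelocity.const _) ?_
  filter_upwards [h₂] with τ hτ
  exact 𝒢.src_mul _ _ hτ

/-- The left- and right-invariant fields of `α` have opposite anchors. -/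
theorem mfderiv_src_leftInvVF {g h : G} (hgh : 𝒢.src g = 𝒢.tgt h) :
    (mfderiv 𝓘(ℝ, EG) 𝓘(ℝ, EM) 𝒢.src g (𝒢.leftInvVF α g) : EM) =
      -(mfderiv 𝓘(ℝ, EG) 𝓘(ℝ, EM) 𝒢.tgt h (𝒢.rightInvVF α h) : EM) := by
  obtain ⟨γ, h₁, h₂⟩ := exists_curve_src_fiber hα (𝒢.src g)
  have h₃ := (hasVelocity_mul_left h₁ h₂ rfl).comp (f := 𝒢.src) contMDiff_src.contMDiffAt
  have h₄ := ((hasVelocity_mul_right h₁ h₂ hgh.symm).comp (f := 𝒢.tgt)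
    contMDiff_tgt.contMDiffAt).cast hgh.symm
  have h₅ : (mfderiv 𝓘(ℝ, EG) 𝓘(ℝ, EM) 𝒢.src g (-𝒢.leftInvVF α g) : EM) =
      (mfderiv 𝓘(ℝ, EG) 𝓘(ℝ, EM) 𝒢.tgt h (𝒢.rightInvVF α h) : EM) := by
    refine h₃.unique h₄ ?_
    filter_upwards [h₂] with τ hτ
    show 𝒢.src (𝒢.mul g (𝒢.inv (γ τ))) = 𝒢.tgt (𝒢.mul (γ τ) h)
    rw [𝒢.src_mul _ _ (by rw [𝒢.tgt_inv, hτ]), 𝒢.src_inv, 𝒢.tgt_mul _ _ (hτ.trans hgh)]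
  rw [← h₅]
  exact neg_eq_iff_eq_neg.1 (map_neg (mfderiv 𝓘(ℝ, EG) 𝓘(ℝ, EM) 𝒢.src g) (𝒢.leftInvVF α g)).symm

/-- Differentiate the associativity law `(γ g) h = γ (g h)`. -/
theorem dmul_rightInvVF {g h : G} (hgh : 𝒢.src g = 𝒢.tgt h) :
    𝒢.dmul g h ((𝒢.rightInvVF α g : EG), 0) = 𝒢.rightInvVF α (𝒢.mul g h) := by
  obtain ⟨γ, h₁, h₂⟩ := exists_curve_src_fiber hα (𝒢.tgt g)
  refine (hasVelocity_mul (hasVelocity_mul_right h₁ h₂ rfl) (HasVelocity.const h) ?_).unique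
    (hasVelocity_mul_right h₁ h₂ (𝒢.tgt_mul _ _ hgh)) ?_
  · filter_upwards [h₂] with τ hτ
    rw [𝒢.src_mul _ _ hτ, hgh]
  · filter_upwards [h₂] with τ hτ
    exact 𝒢.mul_assoc _ _ _ hτ hgh

/-- The curve of products `(g γ⁻¹) (γ h)` is constantly `g h`. This cancellation permits correcting
the first component by lifts of left-invariant fields. -/
theorem dmul_leftInvVF_rightInvVF {g h : G} (hgh : 𝒢.src g = 𝒢.tgt h) :
    𝒢.dmul g h ((-𝒢.leftInvVF α g : EG), (𝒢.rightInvVF α h : EG)) = 0 := by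
  obtain ⟨γ, h₁, h₂⟩ := exists_curve_src_fiber hα (𝒢.src g)
  have h₃ : ∀ᶠ τ in 𝓝 0, 𝒢.src (𝒢.mul g (𝒢.inv (γ τ))) = 𝒢.tgt (𝒢.mul (γ τ) h) := by
    filter_upwards [h₂] with τ hτ
    rw [𝒢.src_mul _ _ (by rw [𝒢.tgt_inv, hτ]), 𝒢.src_inv, 𝒢.tgt_mul _ _ (hτ.trans hgh)]
  refine (hasVelocity_mul (hasVelocity_mul_left h₁ h₂ rfl)
    (hasVelocity_mul_right h₁ h₂ hgh.symm) h₃).unique (HasVelocity.const _) ?_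
  filter_upwards [h₂] with τ hτ
  rw [𝒢.mul_assoc _ _ _ (by rw [𝒢.tgt_inv, hτ])
    (by rw [𝒢.src_inv, 𝒢.tgt_mul _ _ (hτ.trans hgh)]), inv_mul_cancel_left (hτ.trans hgh)]

end

theorem mfderiv_inv_mfderiv_inv (g : G) (v : EG) :
    (mfderiv 𝓘(ℝ, EG) 𝓘(ℝ, EG) 𝒢.inv g
      (mfderiv 𝓘(ℝ, EG) 𝓘(ℝ, EG) 𝒢.inv (𝒢.inv g) v : EG) : EG) = v := by
  obtain ⟨c, hc⟩ := exists_hasVelocity (E := EG) (𝒢.inv g)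
    (v : TangentSpace 𝓘(ℝ, EG) (𝒢.inv g))
  exact (((hc.comp 𝒢.inv_smooth.contMDiffAt).cast (inv_inv g)).comp
    𝒢.inv_smooth.contMDiffAt).unique hc (Eventually.of_forall fun τ => inv_inv _)

theorem mfderiv_inv_leftInvVF (g : G) :
    (mfderiv 𝓘(ℝ, EG) 𝓘(ℝ, EG) 𝒢.inv g (𝒢.leftInvVF α g) : EG) = -(𝒢.rightInvVF α (𝒢.inv g) : EG) :=
  (map_neg (mfderiv 𝓘(ℝ, EG) 𝓘(ℝ, EG) 𝒢.inv g)
    (mfderiv 𝓘(ℝ, EG) 𝓘(ℝ, EG) 𝒢.inv (𝒢.inv g) (𝒢.rightInvVF α (𝒢.inv g)))).trans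
    (congrArg (fun w : EG => -w) (mfderiv_inv_mfderiv_inv (EG := EG) g (𝒢.rightInvVF α (𝒢.inv g))))

theorem mfderiv_inv_rightInvVF (g : G) :
    (mfderiv 𝓘(ℝ, EG) 𝓘(ℝ, EG) 𝒢.inv g (𝒢.rightInvVF α g) : EG) = -(𝒢.leftInvVF α (𝒢.inv g) : EG) := by
  have aux : ∀ g', g' = g → (mfderiv 𝓘(ℝ, EG) 𝓘(ℝ, EG) 𝒢.inv g (𝒢.rightInvVF α g) : EG) =
      (mfderiv 𝓘(ℝ, EG) 𝓘(ℝ, EG) 𝒢.inv g' (𝒢.rightInvVF α g') : EG) := by rintro _ rfl; rfl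
  exact (aux _ (inv_inv g)).trans (neg_neg _).symm

end LieGrpd

/-! ### Composition: linear algebra, fibre products and lifts -/

/-- The linear algebra behind the composition of bisubmersions. -/
theorem map_pair_eq_sum {E₁ E₂ EG EM : Type*} [AddCommGroup E₁] [Module ℝ E₁]
    [AddCommGroup E₂] [Module ℝ E₂] [AddCommGroup EG] [Module ℝ EG] [AddCommGroup EM] [Module ℝ EM]
    (D₁ : E₁ →ₗ[ℝ] EG) (D₂ : E₂ →ₗ[ℝ] EG) (S T : EG →ₗ[ℝ] EM) (m : EG × EG →ₗ[ℝ] EG)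
    {x₁ : E₁} {x₂ : E₂} (hx : S (D₁ x₁) = T (D₂ x₂))
    {J : Type*} [Fintype J] {a : J → ℝ} {r l : J → EG} {w : J → E₁} (hw : ∀ j, D₁ (w j) = l j)
    (hlr : ∀ j, S (l j) = -T (r j)) (hm : ∀ j, m (-l j, r j) = 0)
    (hx₂ : D₂ x₂ = ∑ j, a j • r j)
    {K : Type*} [Fintype K] {θ : K → E₁ →ₗ[ℝ] ℝ} {y : K → E₁}
    (hy : ∀ v, S (D₁ v) = 0 → v = ∑ k, θ k v • y k)
    {L : K → Type*} [∀ k, Fintype (L k)] {b : (k : K) → L k → ℝ} {r' r'' : (k : K) → L k → EG}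
    (hr' : ∀ k, D₁ (y k) = ∑ i, b k i • r' k i) (hr'' : ∀ k i, m (r' k i, 0) = r'' k i) :
    m (D₁ x₁, D₂ x₂) =
      ∑ k : (k : K) × L k, (θ k.1 (x₁ + ∑ j, a j • w j) * b k.1 k.2) • r'' k.1 k.2 := by
  -- Opposite anchors make the corrected vector vertical, so it can be expanded in the frame `y`.
  have h₁ : D₁ (x₁ + ∑ j, a j • w j) = ∑ k, ∑ i, (θ k (x₁ + ∑ j, a j • w j) * b k i) • r' k i := by
    have hv : S (D₁ (x₁ + ∑ j, a j • w j)) = 0 := by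
      simp only [map_add, map_sum, map_smul, hw, hlr, hx, hx₂, smul_neg, Finset.sum_neg_distrib,
        add_neg_cancel]
    conv_lhs => rw [hy _ hv]
    simp only [map_sum, map_smul, hr', Finset.smul_sum, mul_smul]
  -- Split into a part with zero second component and pairs killed by `m`. Each summand is the kind
  -- of pair on which the value of `m` is known.
  have h₂ : (D₁ x₁, D₂ x₂) = (D₁ (x₁ + ∑ j, a j • w j), 0) + ∑ j, a j • (-l j, r j) := by
    ext
    · simp only [map_add, map_sum, map_smul, hw, Prod.fst_add, Prod.fst_sum, Prod.smul_fst, smul_neg,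
        Finset.sum_neg_distrib, add_neg_cancel_right]
    · simp only [Prod.snd_add, Prod.snd_sum, Prod.smul_snd, zero_add, hx₂]
  have h₃ : (D₁ (x₁ + ∑ j, a j • w j), (0 : EG)) =
      ∑ k, ∑ i, (θ k (x₁ + ∑ j, a j • w j) * b k i) • (r' k i, (0 : EG)) := by
    rw [h₁]
    ext
    · simp only [Prod.fst_sum, Prod.smul_fst]
    · simp only [Prod.snd_sum, Prod.smul_snd, smul_zero, Finset.sum_const_zero]
  rw [h₂, h₃, map_add]
  simp only [map_sum, map_smul, hm, hr'', smul_zero, Finset.sum_const_zero, add_zero]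
  rw [Fintype.sum_sigma]

section

variable {EM : Type*} [NormedAddCommGroup EM] [NormedSpace ℝ EM]
  {M : Type*} [TopologicalSpace M] [ChartedSpace EM M]
  {E₁ : Type*} [NormedAddCommGroup E₁] [NormedSpace ℝ E₁]
  {U₁ : Type*} [TopologicalSpace U₁] [ChartedSpace E₁ U₁]
  {E₂ : Type*} [NormedAddCommGroup E₂] [NormedSpace ℝ E₂]
  {U₂ : Type*} [TopologicalSpace U₂] [ChartedSpace E₂ U₂]
  {F : Type*} [NormedAddCommGroup F] [NormedSpace ℝ F]
  {N : Type*} [TopologicalSpace N] [ChartedSpace F N]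

/-- The differential-geometric properties of the fibre product `N` of `q₁` and `q₂` with
projections `π₁`, `π₂`: tangent vectors and vector fields on `N` can be prescribed by their
components. -/
structure IsSmoothFiberProduct [IsManifold 𝓘(ℝ, E₁) ∞ U₁] [IsManifold 𝓘(ℝ, E₂) ∞ U₂]
    [IsManifold 𝓘(ℝ, F) ∞ N] (q₁ : U₁ → M) (q₂ : U₂ → M) (π₁ : N → U₁) (π₂ : N → U₂) : Prop where
  smooth_fst : ContMDiff 𝓘(ℝ, F) 𝓘(ℝ, E₁) ∞ π₁
  smooth_snd : ContMDiff 𝓘(ℝ, F) 𝓘(ℝ, E₂) ∞ π₂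
  comm : ∀ p, q₁ (π₁ p) = q₂ (π₂ p)
  exists_tangent : ∀ (p : N) (v₁ : TangentSpace 𝓘(ℝ, E₁) (π₁ p)) (v₂ : TangentSpace 𝓘(ℝ, E₂) (π₂ p)),
    (mfderiv 𝓘(ℝ, E₁) 𝓘(ℝ, EM) q₁ (π₁ p) v₁ : EM) = (mfderiv 𝓘(ℝ, E₂) 𝓘(ℝ, EM) q₂ (π₂ p) v₂ : EM) →
    ∃ w : TangentSpace 𝓘(ℝ, F) p, mfderiv 𝓘(ℝ, F) 𝓘(ℝ, E₁) π₁ p w = v₁ ∧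
      mfderiv 𝓘(ℝ, F) 𝓘(ℝ, E₂) π₂ p w = v₂
  exists_lift : ∀ (Z₁ : (u : U₁) → TangentSpace 𝓘(ℝ, E₁) u) (Z₂ : (u : U₂) → TangentSpace 𝓘(ℝ, E₂) u),
    IsSmoothVF Z₁ → IsSmoothVF Z₂ →
    (∀ p, (mfderiv 𝓘(ℝ, E₁) 𝓘(ℝ, EM) q₁ (π₁ p) (Z₁ (π₁ p)) : EM) =
      (mfderiv 𝓘(ℝ, E₂) 𝓘(ℝ, EM) q₂ (π₂ p) (Z₂ (π₂ p)) : EM)) →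
    ∃ Z : (p : N) → TangentSpace 𝓘(ℝ, F) p, IsSmoothVF Z ∧ IsRelatedVF π₁ Z Z₁ ∧ IsRelatedVF π₂ Z Z₂

theorem IsSmoothFiberProduct.symm [IsManifold 𝓘(ℝ, E₁) ∞ U₁] [IsManifold 𝓘(ℝ, E₂) ∞ U₂]
    [IsManifold 𝓘(ℝ, F) ∞ N] {q₁ : U₁ → M} {q₂ : U₂ → M} {π₁ : N → U₁} {π₂ : N → U₂}
    (h : IsSmoothFiberProduct (EM := EM) (E₁ := E₁) (E₂ := E₂) (F := F) q₁ q₂ π₁ π₂) :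
    IsSmoothFiberProduct (EM := EM) (E₁ := E₂) (E₂ := E₁) (F := F) q₂ q₁ π₂ π₁ where
  smooth_fst := h.smooth_snd
  smooth_snd := h.smooth_fst
  comm p := (h.comm p).symm
  exists_tangent p v₁ v₂ hv := by
    obtain ⟨w, h₁, h₂⟩ := h.exists_tangent p v₂ v₁ hv.symm
    exact ⟨w, h₂, h₁⟩
  exists_lift Z₁ Z₂ h₁ h₂ hZ := by
    obtain ⟨Z, hZ₀, hZ₁, hZ₂⟩ := h.exists_lift Z₂ Z₁ h₂ h₁ fun p => (hZ p).symm
    exact ⟨Z, hZ₀, hZ₂, hZ₁⟩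

variable {EG : Type*} [NormedAddCommGroup EG] [NormedSpace ℝ EG]
  {G : Type*} [TopologicalSpace G] [ChartedSpace EG G] [IsManifold 𝓘(ℝ, EG) ∞ G]
  [IsManifold 𝓘(ℝ, EM) ∞ M] {𝒢 : LieGrpd EM EG M G} {B : SingularSubalgebroid 𝒢}

theorem SingularSubalgebroid.mfderiv_src_eq_zero {α : (x : M) → TangentSpace 𝓘(ℝ, EG) (𝒢.one x)}
    (hα : α ∈ B.carrier) (x : M) : mfderiv 𝓘(ℝ, EG) 𝓘(ℝ, EM) 𝒢.src (𝒢.one x) (α x) = 0 :=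
  (B.isSection α hα).2 x (Set.mem_univ x)

variable [IsManifold 𝓘(ℝ, F) ∞ N]

/-- The easy inclusion, valid for every smooth map to `G`: right-invariant fields are tangent to the
source fibres. -/
theorem pullbackVF_rightVFs_subset {φ : N → G} (hφ : ContMDiff 𝓘(ℝ, F) 𝓘(ℝ, EG) ∞ φ) :
    (pullbackVF φ B.rightVFs : Set ((u : N) → TangentSpace 𝓘(ℝ, F) u)) ⊆
      verticalVF (E' := EM) (𝒢.src ∘ φ) := by
  intro Z hZ
  obtain ⟨h₁, h₂, n, f, V, hf, hV, hZV⟩ := mem_pullbackVF_iff.1 hZ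
  refine ⟨h₁, h₂, fun p => ?_⟩
  have hc := mfderiv_comp p (LieGrpd.contMDiff_src.mdifferentiableAt (by simp) :
    MDifferentiableAt 𝓘(ℝ, EG) 𝓘(ℝ, EM) 𝒢.src (φ p)) (hφ.mdifferentiableAt (x := p) (by simp))
  rw [hc]
  show mfderiv 𝓘(ℝ, EG) 𝓘(ℝ, EM) 𝒢.src (φ p) (mfderiv 𝓘(ℝ, F) 𝓘(ℝ, EG) φ p (Z p)) = 0
  rw [hZV p, map_sum]
  refine Finset.sum_eq_zero fun i _ => ?_
  obtain ⟨α, hα, hVα⟩ := hV i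
  rw [map_smul, hVα, LieGrpd.mfderiv_src_rightInvVF (B.mfderiv_src_eq_zero hα), smul_zero]

variable [IsManifold 𝓘(ℝ, E₁) ∞ U₁] [IsManifold 𝓘(ℝ, E₂) ∞ U₂]
  {φ₁ : U₁ → G} {φ₂ : U₂ → G} {π₁ : N → U₁} {π₂ : N → U₂}

theorem IsSmoothFiberProduct.contMDiff_mul
    (hN : IsSmoothFiberProduct (EM := EM) (E₁ := E₁) (E₂ := E₂) (F := F)
      (𝒢.src ∘ φ₁) (𝒢.tgt ∘ φ₂) π₁ π₂)
    (hφ₁ : ContMDiff 𝓘(ℝ, E₁) 𝓘(ℝ, EG) ∞ φ₁) (hφ₂ : ContMDiff 𝓘(ℝ, E₂) 𝓘(ℝ, EG) ∞ φ₂) :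
    ContMDiff 𝓘(ℝ, F) 𝓘(ℝ, EG) ∞ fun p => 𝒢.mul (φ₁ (π₁ p)) (φ₂ (π₂ p)) :=
  𝒢.mul_smooth.comp_contMDiff ((hφ₁.comp hN.smooth_fst).prodMk (hφ₂.comp hN.smooth_snd)) hN.comm

theorem IsSmoothFiberProduct.mfderiv_mul
    (hN : IsSmoothFiberProduct (EM := EM) (E₁ := E₁) (E₂ := E₂) (F := F)
      (𝒢.src ∘ φ₁) (𝒢.tgt ∘ φ₂) π₁ π₂)
    (hφ₁ : ContMDiff 𝓘(ℝ, E₁) 𝓘(ℝ, EG) ∞ φ₁) (hφ₂ : ContMDiff 𝓘(ℝ, E₂) 𝓘(ℝ, EG) ∞ φ₂)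
    (p : N) (v : TangentSpace 𝓘(ℝ, F) p) :
    (mfderiv 𝓘(ℝ, F) 𝓘(ℝ, EG) (fun p => 𝒢.mul (φ₁ (π₁ p)) (φ₂ (π₂ p))) p v : EG) =
      𝒢.dmul (φ₁ (π₁ p)) (φ₂ (π₂ p))
        ((mfderiv 𝓘(ℝ, E₁) 𝓘(ℝ, EG) φ₁ (π₁ p) (mfderiv 𝓘(ℝ, F) 𝓘(ℝ, E₁) π₁ p v) : EG),
        (mfderiv 𝓘(ℝ, E₂) 𝓘(ℝ, EG) φ₂ (π₂ p) (mfderiv 𝓘(ℝ, F) 𝓘(ℝ, E₂) π₂ p v) : EG)) := by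
  have e₁ := mfderiv_comp (I := 𝓘(ℝ, F)) p
    (hφ₁.mdifferentiableAt (x := π₁ p) (by simp)) (hN.smooth_fst.mdifferentiableAt (by simp))
  have e₂ := mfderiv_comp (I := 𝓘(ℝ, F)) p
    (hφ₂.mdifferentiableAt (x := π₂ p) (by simp)) (hN.smooth_snd.mdifferentiableAt (by simp))
  refine (LieGrpd.dmul_eq_mfderiv (𝒢 := 𝒢) (hφ₁.comp hN.smooth_fst) (hφ₂.comp hN.smooth_snd)
    hN.comm p v).trans (congrArg (𝒢.dmul (φ₁ (π₁ p)) (φ₂ (π₂ p))) (Prod.ext ?_ ?_))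
  · exact congrArg (fun L : F →L[ℝ] EG => L v) e₁
  · exact congrArg (fun L : F →L[ℝ] EG => L v) e₂

/-- Pair the lift through `φ₁` with the zero field on `U₂`. The pair is tangent to the fibre product
because the lift is vertical for `s ∘ φ₁`. -/
theorem IsSmoothFiberProduct.exists_lift_rightInvVF
    (hN : IsSmoothFiberProduct (EM := EM) (E₁ := E₁) (E₂ := E₂) (F := F)
      (𝒢.src ∘ φ₁) (𝒢.tgt ∘ φ₂) π₁ π₂)
    (hφ₁ : IsBisubmersion (EU := E₁) B φ₁) (hφ₂ : IsBisubmersion (EU := E₂) B φ₂)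
    {α : (x : M) → TangentSpace 𝓘(ℝ, EG) (𝒢.one x)} (hα : α ∈ B.carrier) :
    ∃ Z : (p : N) → TangentSpace 𝓘(ℝ, F) p, IsSmoothVF Z ∧
      IsRelatedVF (fun p => 𝒢.mul (φ₁ (π₁ p)) (φ₂ (π₂ p))) Z (𝒢.rightInvVF α) := by
  obtain ⟨Z₁, hZ₁, hr₁⟩ := hφ₁.lift_right α hα
  have h₀ : IsSmoothVF (fun u : U₂ => (0 : TangentSpace 𝓘(ℝ, E₂) u)) := by
    have : IsManifold 𝓘(ℝ, E₂) 1 U₂ := IsManifold.of_le (n := ∞) (by simp)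
    exact Bundle.contMDiff_zeroSection ℝ (TangentSpace 𝓘(ℝ, E₂) : U₂ → Type _)
  obtain ⟨Z, hZ, hZ₁', hZ₂'⟩ := hN.exists_lift Z₁ (fun _ => 0) hZ₁ h₀ fun p => by
    rw [mfderiv_comp _ (LieGrpd.contMDiff_src.mdifferentiableAt (by simp))
      (hφ₁.smooth.mdifferentiableAt (by simp))]
    have h₁ := LieGrpd.mfderiv_src_rightInvVF (B.mfderiv_src_eq_zero hα) (φ₁ (π₁ p))
    rw [← hr₁ (π₁ p)] at h₁
    exact h₁.trans (map_zero (mfderiv 𝓘(ℝ, E₂) 𝓘(ℝ, EM) (𝒢.tgt ∘ φ₂) (π₂ p))).symm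
  refine ⟨Z, hZ, fun p => (hN.mfderiv_mul hφ₁.smooth hφ₂.smooth p (Z p)).trans ?_⟩
  rw [hZ₁' p, hZ₂' p, hr₁ (π₁ p), map_zero]
  exact LieGrpd.dmul_rightInvVF (B.mfderiv_src_eq_zero hα) (hN.comm p)

end

theorem map_add_sum_smul {E : Type*} [AddCommGroup E] [Module ℝ E] {J : Type*} [Fintype J]
    (L : E →ₗ[ℝ] ℝ) (x : E) (a : J → ℝ) (w : J → E) :
    L (x + ∑ j, a j • w j) = L x + ∑ j, a j * L (w j) := by
  simp

section

variable {EM E₁ F EG : Type*} [NormedAddCommGroup EM] [NormedSpace ℝ EM]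
  [NormedAddCommGroup E₁] [NormedSpace ℝ E₁] [NormedAddCommGroup F] [NormedSpace ℝ F]
  [NormedAddCommGroup EG] [NormedSpace ℝ EG]
  {M U₁ N G : Type*} [TopologicalSpace M] [ChartedSpace EM M]
  [TopologicalSpace U₁] [ChartedSpace E₁ U₁] [TopologicalSpace N] [ChartedSpace F N]
  [TopologicalSpace G] [ChartedSpace EG G]

theorem realDiff_comp {f : N → U₁} {y : U₁ → ℝ} (hy : ContMDiff 𝓘(ℝ, E₁) 𝓘(ℝ, ℝ) ∞ y)
    (hf : ContMDiff 𝓘(ℝ, F) 𝓘(ℝ, E₁) ∞ f) (p : N) (v : TangentSpace 𝓘(ℝ, F) p) :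
    realDiff (y ∘ f) p v = realDiff y (f p) (mfderiv 𝓘(ℝ, F) 𝓘(ℝ, E₁) f p v) :=
  congrArg (fun L : F →L[ℝ] ℝ => L v) (mfderiv_comp (I' := 𝓘(ℝ, E₁)) p
    (hy.mdifferentiableAt (x := f p) (by simp)) (hf.mdifferentiableAt (by simp)))

theorem mfderiv_comp_comp_apply {s : G → M} {φ : U₁ → G} {π : N → U₁}
    (hs : ContMDiff 𝓘(ℝ, EG) 𝓘(ℝ, EM) ∞ s) (hφ : ContMDiff 𝓘(ℝ, E₁) 𝓘(ℝ, EG) ∞ φ)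
    (hπ : ContMDiff 𝓘(ℝ, F) 𝓘(ℝ, E₁) ∞ π) (p : N) (v : TangentSpace 𝓘(ℝ, F) p) :
    (mfderiv 𝓘(ℝ, F) 𝓘(ℝ, EM) (s ∘ φ ∘ π) p v : EM) = mfderiv 𝓘(ℝ, EG) 𝓘(ℝ, EM) s (φ (π p))
      (mfderiv 𝓘(ℝ, E₁) 𝓘(ℝ, EG) φ (π p) (mfderiv 𝓘(ℝ, F) 𝓘(ℝ, E₁) π p v)) := by
  have h₁ := mfderiv_comp (I' := 𝓘(ℝ, E₁)) p (hφ.mdifferentiableAt (x := π p) (by simp))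
    (hπ.mdifferentiableAt (x := p) (by simp))
  have h₂ := mfderiv_comp (I' := 𝓘(ℝ, EG)) p (hs.mdifferentiableAt (x := φ (π p)) (by simp))
    ((hφ.comp hπ).mdifferentiableAt (x := p) (by simp))
  exact (congrArg (fun L : F →L[ℝ] EM => L v) h₂).trans (congrArg (fun L : F →L[ℝ] EG =>
    (mfderiv 𝓘(ℝ, EG) 𝓘(ℝ, EM) s (φ (π p)) : EG →L[ℝ] EM) (L v)) h₁)

end

/-! ### Composition: vertical fields lie in the pullback -/

section

variable {EM : Type*} [NormedAddCommGroup EM] [NormedSpace ℝ EM]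
  {M : Type*} [TopologicalSpace M] [ChartedSpace EM M] [IsManifold 𝓘(ℝ, EM) ∞ M]
  {E₁ : Type*} [NormedAddCommGroup E₁] [NormedSpace ℝ E₁]
  {U₁ : Type*} [TopologicalSpace U₁] [ChartedSpace E₁ U₁] [IsManifold 𝓘(ℝ, E₁) ∞ U₁]
  {E₂ : Type*} [NormedAddCommGroup E₂] [NormedSpace ℝ E₂]
  {U₂ : Type*} [TopologicalSpace U₂] [ChartedSpace E₂ U₂] [IsManifold 𝓘(ℝ, E₂) ∞ U₂]
  {F : Type*} [NormedAddCommGroup F] [NormedSpace ℝ F]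
  {N : Type*} [TopologicalSpace N] [ChartedSpace F N] [IsManifold 𝓘(ℝ, F) ∞ N]
  {EG : Type*} [NormedAddCommGroup EG] [NormedSpace ℝ EG]
  {G : Type*} [TopologicalSpace G] [ChartedSpace EG G] [IsManifold 𝓘(ℝ, EG) ∞ G]
  {𝒢 : LieGrpd EM EG M G} {B : SingularSubalgebroid 𝒢}
  {φ₁ : U₁ → G} {φ₂ : U₂ → G} {π₁ : N → U₁} {π₂ : N → U₂}

theorem contMDiff_realDiff {y : N → ℝ} (hy : ContMDiff 𝓘(ℝ, F) 𝓘(ℝ, ℝ) ∞ y)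
    {Z : (p : N) → TangentSpace 𝓘(ℝ, F) p} (hZ : IsSmoothVF Z) :
    ContMDiff 𝓘(ℝ, F) 𝓘(ℝ, ℝ) ∞ (fun p => realDiff y p (Z p)) :=
  fun p => (hy p).mfderiv_apply_section (hZ p)

/-- The frame of `ker d(src ∘ φ)` for a bisubmersion `φ`, with its images expressed by
right-invariant vector fields. -/
theorem IsBisubmersion.exists_frame [FiniteDimensional ℝ E₁] [T2Space U₁]
    (hφ₁ : IsBisubmersion (EU := E₁) B φ₁) (u₀ : U₁) :
    ∃ (n : ℕ) (Y : Fin n → (u : U₁) → TangentSpace 𝓘(ℝ, E₁) u) (y : Fin n → U₁ → ℝ)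
      (n' : Fin n → ℕ) (f : (j : Fin n) → Fin (n' j) → U₁ → ℝ)
      (α : (j : Fin n) → Fin (n' j) → (x : M) → TangentSpace 𝓘(ℝ, EG) (𝒢.one x)),
      (∀ j, ContMDiff 𝓘(ℝ, E₁) 𝓘(ℝ, ℝ) ∞ (y j)) ∧
      (∀ j k, ContMDiff 𝓘(ℝ, E₁) 𝓘(ℝ, ℝ) ∞ (f j k)) ∧ (∀ j k, α j k ∈ B.carrier) ∧
      (∀ j u, mfderiv 𝓘(ℝ, E₁) 𝓘(ℝ, EG) φ₁ u (Y j u) =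
        ∑ k, f j k u • 𝒢.rightInvVF (α j k) (φ₁ u)) ∧
      ∀ᶠ u in 𝓝 u₀, ∀ v : TangentSpace 𝓘(ℝ, E₁) u,
        mfderiv 𝓘(ℝ, EG) 𝓘(ℝ, EM) 𝒢.src (φ₁ u) (mfderiv 𝓘(ℝ, E₁) 𝓘(ℝ, EG) φ₁ u v) = 0 →
        v = ∑ j, realDiff (y j) u v • Y j u := by
  obtain ⟨n, Y, y, hY, hy, hYy⟩ := (hφ₁.src_submersion.isSubmersionAt u₀).exists_vertical_frame
    hφ₁.src_submersion.contMDiff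
  -- The frame fields are compactly supported vertical fields on the whole manifold, so condition 3
  -- applies to each of them.
  rw [← hφ₁.pullback_right] at hY
  choose _ _ n' f V hf hV hYV using fun j => mem_pullbackVF_iff.1 (hY j)
  choose α hα hVα using hV
  refine ⟨n, Y, y, n', f, α, hy, fun j k => (hf j k).1, hα, fun j u => ?_, ?_⟩
  · simp only [hYV, hVα]
  · filter_upwards [hYy] with u hu v hv
    refine hu v ?_
    rw [mfderiv_comp _ (LieGrpd.contMDiff_src.mdifferentiableAt (by simp) :
      MDifferentiableAt 𝓘(ℝ, EG) 𝓘(ℝ, EM) 𝒢.src (φ₁ u))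
      (hφ₁.smooth.mdifferentiableAt (by simp))]
    exact hv

/-- Near each point, expand the second component in the frame for `φ₂`, correct the first by lifts
of left-invariant fields, and expand the result in the frame for `φ₁`. The coefficients are
differentials of functions evaluated on `X`, hence smooth on `N`. -/
theorem IsSmoothFiberProduct.verticalVF_subset_pullbackVF [FiniteDimensional ℝ E₁] [T2Space U₁]
    [FiniteDimensional ℝ E₂] [T2Space U₂] [FiniteDimensional ℝ F] [T2Space N]
    [SecondCountableTopology N]
    (hN : IsSmoothFiberProduct (EM := EM) (E₁ := E₁) (E₂ := E₂) (F := F)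
      (𝒢.src ∘ φ₁) (𝒢.tgt ∘ φ₂) π₁ π₂)
    (hφ₁ : IsBisubmersion (EU := E₁) B φ₁) (hφ₂ : IsBisubmersion (EU := E₂) B φ₂) :
    verticalVF (E' := EM) (𝒢.src ∘ fun p => 𝒢.mul (φ₁ (π₁ p)) (φ₂ (π₂ p))) ⊆
      (pullbackVF (fun p => 𝒢.mul (φ₁ (π₁ p)) (φ₂ (π₂ p))) B.rightVFs :
        Set ((p : N) → TangentSpace 𝓘(ℝ, F) p)) := by
  rintro X ⟨hX, hXc, hXv⟩
  refine mem_pullbackVF_of_local hX hXc fun p₀ => ?_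
  obtain ⟨n₂, Y₂, y₂, n₂', f₂, α₂, hy₂, hf₂, hα₂, hYα₂, hYy₂⟩ := hφ₂.exists_frame (π₂ p₀)
  obtain ⟨n₁, Y₁, y₁, n₁', f₁, α₁, hy₁, hf₁, hα₁, hYα₁, hYy₁⟩ := hφ₁.exists_frame (π₁ p₀)
  choose W hW hWα using fun j k => hφ₁.lift_left (α₂ j k) (hα₂ j k)
  have ha : ∀ j k, ContMDiff 𝓘(ℝ, F) 𝓘(ℝ, ℝ) ∞
      (fun p => realDiff (y₂ j ∘ π₂) p (X p) * f₂ j k (π₂ p)) := fun j k =>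
    (contMDiff_realDiff ((hy₂ j).comp hN.smooth_snd) hX).mul ((hf₂ j k).comp hN.smooth_snd)
  -- These are the coefficients of `map_pair_eq_sum`, with the differential of `y₁` expanded over
  -- the corrected vector so that every term is visibly smooth in `p`.
  refine ⟨(l : Fin n₁) × Fin (n₁' l), inferInstance, fun i p =>
    (realDiff (y₁ i.1 ∘ π₁) p (X p) + ∑ j : (j : Fin n₂) × Fin (n₂' j),
      realDiff (y₂ j.1 ∘ π₂) p (X p) * f₂ j.1 j.2 (π₂ p) *
        realDiff (y₁ i.1) (π₁ p) (W j.1 j.2 (π₁ p))) * f₁ i.1 i.2 (π₁ p),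
    fun i => 𝒢.rightInvVF (α₁ i.1 i.2), fun i => ?_, fun i => ⟨_, hα₁ i.1 i.2, rfl⟩, ?_⟩
  · refine ((contMDiff_realDiff ((hy₁ i.1).comp hN.smooth_fst) hX).add
      (contMDiff_finsetSum fun j _ => (ha j.1 j.2).mul ?_)).mul
      ((hf₁ i.1 i.2).comp hN.smooth_fst)
    exact (contMDiff_realDiff (hy₁ i.1) (hW j.1 j.2)).comp hN.smooth_fst
  filter_upwards [hN.smooth_fst.continuous.continuousAt.eventually hYy₁,
    hN.smooth_snd.continuous.continuousAt.eventually hYy₂] with p hp₁ hp₂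
  have hgh := hN.comm p
  -- Since `s (g h) = s h`, verticality of `X` concerns only its second component.
  have hsrc : (mfderiv 𝓘(ℝ, EG) 𝓘(ℝ, EM) 𝒢.src (φ₂ (π₂ p)) (mfderiv 𝓘(ℝ, E₂) 𝓘(ℝ, EG) φ₂ (π₂ p)
      (mfderiv 𝓘(ℝ, F) 𝓘(ℝ, E₂) π₂ p (X p))) : EM) = 0 := by
    have h₁ : (𝒢.src ∘ fun p => 𝒢.mul (φ₁ (π₁ p)) (φ₂ (π₂ p))) = 𝒢.src ∘ φ₂ ∘ π₂ :=
      funext fun p => 𝒢.src_mul _ _ (hN.comm p)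
    exact (mfderiv_comp_comp_apply LieGrpd.contMDiff_src hφ₂.smooth hN.smooth_snd p (X p)).symm.trans
      ((congrArg (fun f : N → M => (mfderiv 𝓘(ℝ, F) 𝓘(ℝ, EM) f p (X p) : EM)) h₁).symm.trans (hXv p))
  have hcomm : (mfderiv 𝓘(ℝ, EG) 𝓘(ℝ, EM) 𝒢.src (φ₁ (π₁ p)) (mfderiv 𝓘(ℝ, E₁) 𝓘(ℝ, EG) φ₁ (π₁ p)
      (mfderiv 𝓘(ℝ, F) 𝓘(ℝ, E₁) π₁ p (X p))) : EM) =
      (mfderiv 𝓘(ℝ, EG) 𝓘(ℝ, EM) 𝒢.tgt (φ₂ (π₂ p)) (mfderiv 𝓘(ℝ, E₂) 𝓘(ℝ, EG) φ₂ (π₂ p)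
      (mfderiv 𝓘(ℝ, F) 𝓘(ℝ, E₂) π₂ p (X p))) : EM) := by
    have h₁ : 𝒢.src ∘ φ₁ ∘ π₁ = 𝒢.tgt ∘ φ₂ ∘ π₂ := funext hN.comm
    exact (mfderiv_comp_comp_apply LieGrpd.contMDiff_src hφ₁.smooth hN.smooth_fst p (X p)).symm.trans
      ((congrArg (fun f : N → M => (mfderiv 𝓘(ℝ, F) 𝓘(ℝ, EM) f p (X p) : EM)) h₁).trans
      (mfderiv_comp_comp_apply LieGrpd.contMDiff_tgt hφ₂.smooth hN.smooth_snd p (X p)))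
  refine (hN.mfderiv_mul hφ₁.smooth hφ₂.smooth p (X p)).trans ?_
  have hx₂ : (mfderiv 𝓘(ℝ, E₂) 𝓘(ℝ, EG) φ₂ (π₂ p)
      (mfderiv 𝓘(ℝ, F) 𝓘(ℝ, E₂) π₂ p (X p)) : EG) =
      ∑ j : (j : Fin n₂) × Fin (n₂' j), (realDiff (y₂ j.1 ∘ π₂) p (X p) * f₂ j.1 j.2 (π₂ p)) •
        (𝒢.rightInvVF (α₂ j.1 j.2) (φ₂ (π₂ p)) : EG) := by
    rw [Fintype.sum_sigma]
    conv_lhs => rw [hp₂ _ hsrc, map_sum]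
    refine Finset.sum_congr rfl fun j _ => ?_
    rw [map_smul, hYα₂, Finset.smul_sum]
    refine Finset.sum_congr rfl fun k _ => ?_
    rw [← realDiff_comp (hy₂ j) hN.smooth_snd, smul_smul]
  have key := map_pair_eq_sum (E₁ := E₁) (E₂ := E₂) (EG := EG) (EM := EM)
    (mfderiv 𝓘(ℝ, E₁) 𝓘(ℝ, EG) φ₁ (π₁ p) : E₁ →L[ℝ] EG).toLinearMap
    (mfderiv 𝓘(ℝ, E₂) 𝓘(ℝ, EG) φ₂ (π₂ p) : E₂ →L[ℝ] EG).toLinearMap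
    (mfderiv 𝓘(ℝ, EG) 𝓘(ℝ, EM) 𝒢.src (φ₁ (π₁ p)) : EG →L[ℝ] EM).toLinearMap
    (mfderiv 𝓘(ℝ, EG) 𝓘(ℝ, EM) 𝒢.tgt (φ₂ (π₂ p)) : EG →L[ℝ] EM).toLinearMap
    (𝒢.dmul (φ₁ (π₁ p)) (φ₂ (π₂ p))).toLinearMap
    (x₁ := (mfderiv 𝓘(ℝ, F) 𝓘(ℝ, E₁) π₁ p (X p) : E₁))
    (x₂ := (mfderiv 𝓘(ℝ, F) 𝓘(ℝ, E₂) π₂ p (X p) : E₂)) hcomm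
    (J := (j : Fin n₂) × Fin (n₂' j))
    (a := fun j => realDiff (y₂ j.1 ∘ π₂) p (X p) * f₂ j.1 j.2 (π₂ p))
    (r := fun j => 𝒢.rightInvVF (α₂ j.1 j.2) (φ₂ (π₂ p)))
    (l := fun j => 𝒢.leftInvVF (α₂ j.1 j.2) (φ₁ (π₁ p)))
    (w := fun j => W j.1 j.2 (π₁ p))
    (fun j => hWα j.1 j.2 (π₁ p))
    (fun j => LieGrpd.mfderiv_src_leftInvVF (B.mfderiv_src_eq_zero (hα₂ j.1 j.2)) hgh)
    (fun j => LieGrpd.dmul_leftInvVF_rightInvVF (B.mfderiv_src_eq_zero (hα₂ j.1 j.2)) hgh)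
    hx₂ (K := Fin n₁) (θ := fun l => (realDiff (y₁ l) (π₁ p) : E₁ →L[ℝ] ℝ).toLinearMap)
    (y := fun l => Y₁ l (π₁ p)) hp₁ (L := fun l => Fin (n₁' l))
    (b := fun l i => f₁ l i (π₁ p)) (r' := fun l i => 𝒢.rightInvVF (α₁ l i) (φ₁ (π₁ p)))
    (r'' := fun l i => 𝒢.rightInvVF (α₁ l i) (𝒢.mul (φ₁ (π₁ p)) (φ₂ (π₂ p))))
    (fun l => hYα₁ l (π₁ p))
    (fun l i => LieGrpd.dmul_rightInvVF (B.mfderiv_src_eq_zero (hα₁ l i)) hgh)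
  refine key.trans (Finset.sum_congr rfl fun i _ => ?_)
  congr 2
  refine (map_add_sum_smul _ _ _ _).trans ?_
  exact congrArg (· + _) (realDiff_comp (hy₁ i.1) hN.smooth_fst p (X p)).symm

end

/-! ### Inversion and the composition of bisubmersions -/

section

variable {EM : Type*} [NormedAddCommGroup EM] [NormedSpace ℝ EM]
  {M : Type*} [TopologicalSpace M] [ChartedSpace EM M] [IsManifold 𝓘(ℝ, EM) ∞ M]
  {E₁ : Type*} [NormedAddCommGroup E₁] [NormedSpace ℝ E₁]
  {U₁ : Type*} [TopologicalSpace U₁] [ChartedSpace E₁ U₁] [IsManifold 𝓘(ℝ, E₁) ∞ U₁]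
  {E₂ : Type*} [NormedAddCommGroup E₂] [NormedSpace ℝ E₂]
  {U₂ : Type*} [TopologicalSpace U₂] [ChartedSpace E₂ U₂] [IsManifold 𝓘(ℝ, E₂) ∞ U₂]
  {F : Type*} [NormedAddCommGroup F] [NormedSpace ℝ F]
  {N : Type*} [TopologicalSpace N] [ChartedSpace F N]
  {EG : Type*} [NormedAddCommGroup EG] [NormedSpace ℝ EG]
  {G : Type*} [TopologicalSpace G] [ChartedSpace EG G] [IsManifold 𝓘(ℝ, EG) ∞ G]
  {𝒢 : LieGrpd EM EG M G} {B : SingularSubalgebroid 𝒢}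
  {φ : N → G} {φ₁ : U₁ → G} {φ₂ : U₂ → G} {π₁ : N → U₁} {π₂ : N → U₂}

theorem LieGrpd.inv_comp_inv_comp {N : Type*} {φ : N → G} :
    𝒢.inv ∘ 𝒢.inv ∘ φ = φ := funext fun _ => LieGrpd.inv_inv _

theorem LieGrpd.src_comp_inv_comp {N : Type*} {φ : N → G} :
    𝒢.src ∘ 𝒢.inv ∘ φ = 𝒢.tgt ∘ φ := funext fun _ => 𝒢.src_inv _

theorem LieGrpd.tgt_comp_inv_comp {N : Type*} {φ : N → G} :
    𝒢.tgt ∘ 𝒢.inv ∘ φ = 𝒢.src ∘ φ := funext fun _ => 𝒢.tgt_inv _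

theorem mfderiv_inv_comp_apply (hφ : ContMDiff 𝓘(ℝ, F) 𝓘(ℝ, EG) ∞ φ) (p : N)
    (v : TangentSpace 𝓘(ℝ, F) p) :
    (mfderiv 𝓘(ℝ, F) 𝓘(ℝ, EG) (𝒢.inv ∘ φ) p v : EG) =
      mfderiv 𝓘(ℝ, EG) 𝓘(ℝ, EG) 𝒢.inv (φ p) (mfderiv 𝓘(ℝ, F) 𝓘(ℝ, EG) φ p v) :=
  congrArg (fun L : F →L[ℝ] EG => L v) (mfderiv_comp (I' := 𝓘(ℝ, EG)) p
    (𝒢.inv_smooth.mdifferentiableAt (x := φ p) (by simp)) (hφ.mdifferentiableAt (by simp)))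

variable [IsManifold 𝓘(ℝ, F) ∞ N]

/-- Inversion maps a left-invariant field to minus the right-invariant one; the sign is absorbed in
the coefficients. -/
theorem pullbackVF_leftVFs_subset_inv (hφ : ContMDiff 𝓘(ℝ, F) 𝓘(ℝ, EG) ∞ φ) :
    (pullbackVF φ B.leftVFs : Set ((u : N) → TangentSpace 𝓘(ℝ, F) u)) ⊆
      pullbackVF (𝒢.inv ∘ φ) B.rightVFs := by
  intro Z hZ
  obtain ⟨h₁, h₂, n, f, V, hf, hV, hZV⟩ := mem_pullbackVF_iff.1 hZ
  choose α hα hVα using hV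
  refine mem_pullbackVF_iff.2 ⟨h₁, h₂, n, fun i p => -f i p, fun i => 𝒢.rightInvVF (α i),
    fun i => ⟨(hf i).1.neg, (hf i).2.neg⟩, fun i => ⟨_, hα i, rfl⟩, fun p => ?_⟩
  refine (mfderiv_inv_comp_apply hφ p (Z p)).trans ?_
  rw [hZV p, map_sum]
  refine Finset.sum_congr rfl fun i _ => ?_
  rw [map_smul, hVα]
  exact (congrArg (fun w : EG => f i p • w) (LieGrpd.mfderiv_inv_leftInvVF (φ p))).trans
    ((smul_neg _ _).trans (neg_smul _ _).symm)

theorem pullbackVF_rightVFs_subset_inv (hφ : ContMDiff 𝓘(ℝ, F) 𝓘(ℝ, EG) ∞ φ) :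
    (pullbackVF φ B.rightVFs : Set ((u : N) → TangentSpace 𝓘(ℝ, F) u)) ⊆
      pullbackVF (𝒢.inv ∘ φ) B.leftVFs := by
  intro Z hZ
  obtain ⟨h₁, h₂, n, f, V, hf, hV, hZV⟩ := mem_pullbackVF_iff.1 hZ
  choose α hα hVα using hV
  refine mem_pullbackVF_iff.2 ⟨h₁, h₂, n, fun i p => -f i p, fun i => 𝒢.leftInvVF (α i),
    fun i => ⟨(hf i).1.neg, (hf i).2.neg⟩, fun i => ⟨_, hα i, rfl⟩, fun p => ?_⟩
  refine (mfderiv_inv_comp_apply hφ p (Z p)).trans ?_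
  rw [hZV p, map_sum]
  refine Finset.sum_congr rfl fun i _ => ?_
  rw [map_smul, hVα]
  exact (congrArg (fun w : EG => f i p • w) (LieGrpd.mfderiv_inv_rightInvVF (φ p))).trans
    ((smul_neg _ _).trans (neg_smul _ _).symm)

/-- One inclusion is direct; the other is the mirror inclusion applied to `i ∘ φ`, as `i` is an
involution. -/
theorem pullbackVF_inv_rightVFs (hφ : ContMDiff 𝓘(ℝ, F) 𝓘(ℝ, EG) ∞ φ) :
    (pullbackVF (𝒢.inv ∘ φ) B.rightVFs : Set ((u : N) → TangentSpace 𝓘(ℝ, F) u)) =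
      pullbackVF φ B.leftVFs := by
  refine Set.Subset.antisymm ?_ (pullbackVF_leftVFs_subset_inv hφ)
  have h := pullbackVF_rightVFs_subset_inv (B := B) (𝒢.inv_smooth.comp hφ)
  rwa [LieGrpd.inv_comp_inv_comp] at h

theorem pullbackVF_inv_leftVFs (hφ : ContMDiff 𝓘(ℝ, F) 𝓘(ℝ, EG) ∞ φ) :
    (pullbackVF (𝒢.inv ∘ φ) B.leftVFs : Set ((u : N) → TangentSpace 𝓘(ℝ, F) u)) =
      pullbackVF φ B.rightVFs := by
  have h := pullbackVF_inv_rightVFs (B := B) (𝒢.inv_smooth.comp hφ)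
  rw [LieGrpd.inv_comp_inv_comp] at h
  exact h.symm

theorem exists_lift_rightInvVF_inv {α : (x : M) → TangentSpace 𝓘(ℝ, EG) (𝒢.one x)}
    (hφ : ContMDiff 𝓘(ℝ, F) 𝓘(ℝ, EG) ∞ φ)
    (h : ∃ W : (u : N) → TangentSpace 𝓘(ℝ, F) u, IsSmoothVF W ∧ IsRelatedVF φ W (𝒢.leftInvVF α)) :
    ∃ W : (u : N) → TangentSpace 𝓘(ℝ, F) u,
      IsSmoothVF W ∧ IsRelatedVF (𝒢.inv ∘ φ) W (𝒢.rightInvVF α) := by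
  obtain ⟨W, hW, hWα⟩ := h
  have : IsManifold 𝓘(ℝ, F) 1 N := IsManifold.of_le (n := ∞) (by simp)
  refine ⟨fun p => -W p, hW.neg_section, fun p => ?_⟩
  rw [map_neg]
  refine (congrArg (fun w : EG => -w) ((mfderiv_inv_comp_apply hφ p (W p)).trans ?_)).trans
    (neg_neg _)
  rw [hWα p]
  exact LieGrpd.mfderiv_inv_leftInvVF (φ p)

theorem exists_lift_leftInvVF_inv {α : (x : M) → TangentSpace 𝓘(ℝ, EG) (𝒢.one x)}
    (hφ : ContMDiff 𝓘(ℝ, F) 𝓘(ℝ, EG) ∞ φ)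
    (h : ∃ W : (u : N) → TangentSpace 𝓘(ℝ, F) u, IsSmoothVF W ∧ IsRelatedVF φ W (𝒢.rightInvVF α)) :
    ∃ W : (u : N) → TangentSpace 𝓘(ℝ, F) u,
      IsSmoothVF W ∧ IsRelatedVF (𝒢.inv ∘ φ) W (𝒢.leftInvVF α) := by
  obtain ⟨W, hW, hWα⟩ := h
  have : IsManifold 𝓘(ℝ, F) 1 N := IsManifold.of_le (n := ∞) (by simp)
  refine ⟨fun p => -W p, hW.neg_section, fun p => ?_⟩
  rw [map_neg]
  refine (congrArg (fun w : EG => -w) ((mfderiv_inv_comp_apply hφ p (W p)).trans ?_)).trans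
    (neg_neg _)
  rw [hWα p]
  exact LieGrpd.mfderiv_inv_rightInvVF (φ p)

/-- The inverse of a bisubmersion. -/
theorem IsBisubmersion.inv (hφ : IsBisubmersion (EU := F) B φ) :
    IsBisubmersion (EU := F) B (𝒢.inv ∘ φ) where
  smooth := 𝒢.inv_smooth.comp hφ.smooth
  src_submersion := by rw [LieGrpd.src_comp_inv_comp]; exact hφ.tgt_submersion
  tgt_submersion := by rw [LieGrpd.tgt_comp_inv_comp]; exact hφ.src_submersion
  lift_right α hα := exists_lift_rightInvVF_inv hφ.smooth (hφ.lift_left α hα)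
  lift_left α hα := exists_lift_leftInvVF_inv hφ.smooth (hφ.lift_right α hα)
  pullback_right := by
    rw [LieGrpd.src_comp_inv_comp, pullbackVF_inv_rightVFs hφ.smooth, hφ.pullback_left]
  pullback_left := by
    rw [LieGrpd.tgt_comp_inv_comp, pullbackVF_inv_leftVFs hφ.smooth, hφ.pullback_right]

/-- As `s (g h) = s h`, lift `w` through `s ∘ φ₂` to `v₂`, then complete `v₂` to a tangent vector of
the fibre product using that `s ∘ φ₁` is a submersion. -/
theorem IsSmoothFiberProduct.src_submersion [FiniteDimensional ℝ EM] [FiniteDimensional ℝ F]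
    (hN : IsSmoothFiberProduct (EM := EM) (E₁ := E₁) (E₂ := E₂) (F := F)
      (𝒢.src ∘ φ₁) (𝒢.tgt ∘ φ₂) π₁ π₂)
    (hφ₁ : IsBisubmersion (EU := E₁) B φ₁) (hφ₂ : IsBisubmersion (EU := E₂) B φ₂) :
    Manifold.IsSubmersion 𝓘(ℝ, F) 𝓘(ℝ, EM) ∞
      (𝒢.src ∘ fun p => 𝒢.mul (φ₁ (π₁ p)) (φ₂ (π₂ p))) := by
  have h₁ : (𝒢.src ∘ fun p => 𝒢.mul (φ₁ (π₁ p)) (φ₂ (π₂ p))) = (𝒢.src ∘ φ₂) ∘ π₂ :=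
    funext fun p => 𝒢.src_mul _ _ (hN.comm p)
  rw [h₁]
  refine ContMDiff.isSubmersion (hφ₂.src_submersion.contMDiff.comp hN.smooth_snd) fun p w => ?_
  obtain ⟨v₂, hv₂⟩ := (hφ₂.src_submersion.isSubmersionAt (π₂ p)).surjective_mfderiv w
  obtain ⟨v₁, hv₁⟩ := (hφ₁.src_submersion.isSubmersionAt (π₁ p)).surjective_mfderiv
    (mfderiv 𝓘(ℝ, E₂) 𝓘(ℝ, EM) (𝒢.tgt ∘ φ₂) (π₂ p) v₂ : EM)
  obtain ⟨v, -, hv⟩ := hN.exists_tangent p v₁ v₂ hv₁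
  refine ⟨v, ?_⟩
  rw [mfderiv_comp (I' := 𝓘(ℝ, E₂)) p
    (hφ₂.src_submersion.contMDiff.mdifferentiableAt (by simp))
    (hN.smooth_snd.mdifferentiableAt (by simp))]
  exact (congrArg (fun v => mfderiv 𝓘(ℝ, E₂) 𝓘(ℝ, EM) (𝒢.src ∘ φ₂) (π₂ p) v) hv).trans hv₂

/-- The composition of two bisubmersions. -/
theorem IsSmoothFiberProduct.isBisubmersion_mul [FiniteDimensional ℝ EM]
    [FiniteDimensional ℝ E₁] [T2Space U₁] [FiniteDimensional ℝ E₂] [T2Space U₂]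
    [FiniteDimensional ℝ F] [T2Space N] [SecondCountableTopology N]
    (hN : IsSmoothFiberProduct (EM := EM) (E₁ := E₁) (E₂ := E₂) (F := F)
      (𝒢.src ∘ φ₁) (𝒢.tgt ∘ φ₂) π₁ π₂)
    (hφ₁ : IsBisubmersion (EU := E₁) B φ₁) (hφ₂ : IsBisubmersion (EU := E₂) B φ₂) :
    IsBisubmersion (EU := F) B fun p => 𝒢.mul (φ₁ (π₁ p)) (φ₂ (π₂ p)) := by
  have hs := hN.contMDiff_mul hφ₁.smooth hφ₂.smooth
  -- With the factors swapped and inverted, the same space `N` is the fibre product for the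
  -- composition `φ₂⁻¹ · φ₁⁻¹ = (φ₁ · φ₂)⁻¹`. The source statements for it are the target statements
  -- for `φ₁ · φ₂`.
  have hN' : IsSmoothFiberProduct (EM := EM) (E₁ := E₂) (E₂ := E₁) (F := F)
      (𝒢.src ∘ 𝒢.inv ∘ φ₂) (𝒢.tgt ∘ 𝒢.inv ∘ φ₁) π₂ π₁ := by
    rw [LieGrpd.src_comp_inv_comp, LieGrpd.tgt_comp_inv_comp]
    exact hN.symm
  have hinv : (fun p => 𝒢.mul ((𝒢.inv ∘ φ₂) (π₂ p)) ((𝒢.inv ∘ φ₁) (π₁ p))) =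
      𝒢.inv ∘ fun p => 𝒢.mul (φ₁ (π₁ p)) (φ₂ (π₂ p)) :=
    funext fun p => (LieGrpd.mul_inv_rev (hN.comm p)).symm
  have hs' := 𝒢.inv_smooth.comp hs
  have hsub := hN'.src_submersion hφ₂.inv hφ₁.inv
  have hvert := hN'.verticalVF_subset_pullbackVF hφ₂.inv hφ₁.inv
  rw [hinv, LieGrpd.src_comp_inv_comp] at hsub hvert
  rw [pullbackVF_inv_rightVFs hs] at hvert
  refine ⟨hs, hN.src_submersion hφ₁ hφ₂, hsub,
    fun α hα => hN.exists_lift_rightInvVF hφ₁ hφ₂ hα, fun α hα => ?_,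
    Set.Subset.antisymm (pullbackVF_rightVFs_subset hs)
      (hN.verticalVF_subset_pullbackVF hφ₁ hφ₂), Set.Subset.antisymm ?_ hvert⟩
  · have h := hN'.exists_lift_rightInvVF hφ₂.inv hφ₁.inv hα
    rw [hinv] at h
    have h' := exists_lift_leftInvVF_inv hs' h
    rwa [LieGrpd.inv_comp_inv_comp] at h'
  · rw [← pullbackVF_inv_rightVFs hs, ← LieGrpd.src_comp_inv_comp]
    exact pullbackVF_rightVFs_subset hs'

end

/-! ### Submanifolds from slice charts -/

section Slice

variable {E F EX : Type*} [NormedAddCommGroup E] [NormedSpace ℝ E] [NormedAddCommGroup F]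
  [NormedSpace ℝ F] [NormedAddCommGroup EX] [NormedSpace ℝ EX]
  {H : Type*} [TopologicalSpace H] (J : ModelWithCorners ℝ EX H)
  {X : Type*} [TopologicalSpace X]

theorem ModelWithCorners.apply_symm_apply_of_boundaryless [J.Boundaryless] (v : EX) :
    J (J.symm v) = v :=
  J.right_inv (by rw [J.range_eq_univ]; trivial)

open Classical in
/-- The chart of a subset of `X` induced by a slice chart `Φ` of `X`. -/
def sliceChart [J.Boundaryless] {W : Set X} (Φ : OpenPartialHomeomorph X H)
    (A : (E × F) ≃L[ℝ] EX) (hW : ∀ x ∈ Φ.source, x ∈ W ↔ (A.symm (J (Φ x))).2 = 0) (w : W) :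
    OpenPartialHomeomorph W E where
  toFun x := (A.symm (J (Φ x))).1
  -- The point `w` is only a default value; on the target the first branch always applies.
  invFun y := if h : Φ.symm (J.symm (A (y, 0))) ∈ W then ⟨_, h⟩ else w
  source := Subtype.val ⁻¹' Φ.source
  target := {y | J.symm (A (y, 0)) ∈ Φ.target}
  map_source' x hx := by
    have h₁ : A ((A.symm (J (Φ x))).1, 0) = J (Φ x) := by
      rw [← (hW x hx).1 x.2, Prod.mk.eta, A.apply_symm_apply]
    show J.symm (A ((A.symm (J (Φ x))).1, 0)) ∈ Φ.target
    rw [h₁, J.left_inv]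
    exact Φ.map_source hx
  map_target' y hy := by
    have h₂ : Φ.symm (J.symm (A (y, 0))) ∈ W := by
      rw [hW _ (Φ.map_target hy), Φ.right_inv hy, J.apply_symm_apply_of_boundaryless,
        A.symm_apply_apply]
    simp only [h₂, dite_true, Set.mem_preimage]
    exact Φ.map_target hy
  left_inv' x hx := by
    have h₁ : A ((A.symm (J (Φ x))).1, 0) = J (Φ x) := by
      rw [← (hW x hx).1 x.2, Prod.mk.eta, A.apply_symm_apply]
    have h₂ : Φ.symm (J.symm (A ((A.symm (J (Φ x))).1, 0))) = x := by
      rw [h₁, J.left_inv, Φ.left_inv hx]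
    simp only [h₂, Subtype.coe_prop, dite_true]
  right_inv' y hy := by
    have h₂ : Φ.symm (J.symm (A (y, 0))) ∈ W := by
      rw [hW _ (Φ.map_target hy), Φ.right_inv hy, J.apply_symm_apply_of_boundaryless,
        A.symm_apply_apply]
    simp only [h₂, dite_true]
    rw [Φ.right_inv hy, J.apply_symm_apply_of_boundaryless, A.symm_apply_apply]
  open_source := Φ.open_source.preimage continuous_subtype_val
  open_target := Φ.open_target.preimage (by fun_prop)
  continuousOn_toFun := by
    refine continuous_fst.comp_continuousOn (A.symm.continuous.comp_continuousOn
      (J.continuous.comp_continuousOn ?_))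
    exact Φ.continuousOn.comp continuous_subtype_val.continuousOn fun x hx => hx
  continuousOn_invFun := by
    rw [Topology.IsEmbedding.subtypeVal.isInducing.continuousOn_iff]
    refine ContinuousOn.congr (f := fun y => Φ.symm (J.symm (A (y, 0)))) ?_ fun y hy => ?_
    · exact Φ.continuousOn_symm.comp (by fun_prop) fun y hy => hy
    · have h₂ : Φ.symm (J.symm (A (y, 0))) ∈ W := by
        rw [hW _ (Φ.map_target hy), Φ.right_inv hy, J.apply_symm_apply_of_boundaryless,
          A.symm_apply_apply]
      simp only [Function.comp_apply, h₂, dite_true]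

theorem sliceChart_symm_apply [J.Boundaryless] {W : Set X} (Φ : OpenPartialHomeomorph X H)
    (A : (E × F) ≃L[ℝ] EX) (hW : ∀ x ∈ Φ.source, x ∈ W ↔ (A.symm (J (Φ x))).2 = 0) (w : W)
    {y : E} (hy : y ∈ (sliceChart J Φ A hW w).target) :
    ((sliceChart J Φ A hW w).symm y : X) = Φ.symm (J.symm (A (y, 0))) := by
  have hy' : J.symm (A (y, 0)) ∈ Φ.target := hy
  have h₂ : Φ.symm (J.symm (A (y, 0))) ∈ W := by
    rw [hW _ (Φ.map_target hy'), Φ.right_inv hy', J.apply_symm_apply_of_boundaryless,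
      A.symm_apply_apply]
  classical
  exact congrArg Subtype.val (dif_pos h₂)

/-- A subset covered by slice charts is an embedded submanifold. -/
theorem exists_isSmoothEmbedding_of_slices [J.Boundaryless] [ChartedSpace H X] [IsManifold J ∞ X]
    {W : Set X}
    (h : ∀ w ∈ W, ∃ Φ ∈ IsManifold.maximalAtlas J ∞ X, w ∈ Φ.source ∧
      ∃ A : (E × F) ≃L[ℝ] EX, ∀ x ∈ Φ.source, x ∈ W ↔ (A.symm (J (Φ x))).2 = 0) :
    ∃ _ : ChartedSpace E W, IsManifold 𝓘(ℝ, E) ∞ W ∧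
      Manifold.IsSmoothEmbedding 𝓘(ℝ, E) J ∞ (Subtype.val : W → X) := by
  choose Φ hΦ hs A hA using fun w : W => h w w.2
  let c : ChartedSpace E W :=
    { atlas := Set.range fun w => sliceChart J (Φ w) (A w) (hA w) w
      chartAt := fun w => sliceChart J (Φ w) (A w) (hA w) w
      mem_chart_source := fun w => hs w
      chart_mem_atlas := fun w => ⟨w, rfl⟩ }
  have hm : IsManifold 𝓘(ℝ, E) ∞ W := by
    refine isManifold_of_contDiffOn _ _ _ ?_
    rintro _ _ ⟨w, rfl⟩ ⟨w', rfl⟩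
    rw [← contMDiffOn_iff_contDiffOn]
    -- A transition map factors through `X`: include the slice by the inverse of one ambient chart,
    -- then project with the other.
    have h₁ : ContMDiffOn 𝓘(ℝ, E) J ∞ (fun y => (Φ w).symm (J.symm (A w (y, 0))))
        {y | J.symm (A w (y, 0)) ∈ (Φ w).target} := by
      have h₂ : ContMDiff 𝓘(ℝ, E) 𝓘(ℝ, EX) ∞ (fun y => A w (y, 0)) :=
        ((A w).contDiff.comp (contDiff_id.prodMk contDiff_const)).contMDiff
      have h₃ : ContMDiff 𝓘(ℝ, EX) J ∞ J.symm := by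
        rw [← contMDiffOn_univ, ← J.range_eq_univ]
        exact J.contMDiffOn_symm
      exact (contMDiffOn_symm_of_mem_maximalAtlas (hΦ w)).comp (h₃.comp h₂).contMDiffOn
        fun y hy => hy
    have h₄ : ContMDiffOn J 𝓘(ℝ, E) ∞ (fun x => ((A w').symm (J (Φ w' x))).1) (Φ w').source := by
      have h₅ : ContMDiff 𝓘(ℝ, EX) 𝓘(ℝ, E) ∞ fun v => ((A w').symm v).1 :=
        (contDiff_fst.comp (A w').symm.contDiff).contMDiff
      exact (h₅.comp J.contMDiff).comp_contMDiffOn (contMDiffOn_of_mem_maximalAtlas (hΦ w'))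
    have h₆ : ∀ y ∈ (sliceChart J (Φ w) (A w) (hA w) w).target,
        ((sliceChart J (Φ w) (A w) (hA w) w).symm y : X) = (Φ w).symm (J.symm (A w (y, 0))) :=
      fun y hy => sliceChart_symm_apply J (Φ w) (A w) (hA w) w hy
    refine ContMDiffOn.congr (f := fun y =>
      ((A w').symm (J (Φ w' ((Φ w).symm (J.symm (A w (y, 0))))))).1) ?_ ?_
    · refine h₄.comp (h₁.mono ?_) ?_
      · rintro y ⟨hy, -⟩
        exact hy.1
      · rintro y ⟨hy, -⟩
        have := hy.2
        show (Φ w).symm (J.symm (A w (y, 0))) ∈ (Φ w').source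
        rw [← h₆ y hy.1]
        exact this
    · rintro y ⟨hy, -⟩
      show ((A w').symm (J (Φ w' ((sliceChart J (Φ w) (A w) (hA w) w).symm y : W)))).1 = _
      rw [h₆ y hy.1]
  refine ⟨c, hm, ⟨Manifold.IsImmersionOfComplement.isImmersion (F := F) fun w => ?_,
    Topology.IsEmbedding.subtypeVal⟩⟩
  refine Manifold.IsImmersionAtOfComplement.mk_of_charts (A w)
    (sliceChart J (Φ w) (A w) (hA w) w) (Φ w) (hs w) (hs w)
    (IsManifold.chart_mem_maximalAtlas w) (hΦ w) (fun x hx => hx) fun y hy => ?_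
  have hy' : y ∈ (sliceChart J (Φ w) (A w) (hA w) w).target := by
    simpa [OpenPartialHomeomorph.extend] using hy
  show J (Φ w ((sliceChart J (Φ w) (A w) (hA w) w).symm y : W)) = A w (y, 0)
  rw [sliceChart_symm_apply J (Φ w) (A w) (hA w) w hy', (Φ w).right_inv hy',
    J.apply_symm_apply_of_boundaryless]

end Slice

/-! ### The fibre product is an embedded submanifold -/

section FiberProduct

variable {EM : Type*} [NormedAddCommGroup EM] [NormedSpace ℝ EM]
  {M : Type*} [TopologicalSpace M] [ChartedSpace EM M] [IsManifold 𝓘(ℝ, EM) ∞ M]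
  {E₁ : Type*} [NormedAddCommGroup E₁] [NormedSpace ℝ E₁]
  {U₁ : Type*} [TopologicalSpace U₁] [ChartedSpace E₁ U₁] [IsManifold 𝓘(ℝ, E₁) ∞ U₁]
  {E₂ : Type*} [NormedAddCommGroup E₂] [NormedSpace ℝ E₂]
  {U₂ : Type*} [TopologicalSpace U₂] [ChartedSpace E₂ U₂] [IsManifold 𝓘(ℝ, E₂) ∞ U₂]

/-- The product of a submersion chart `ψ` and a chart `ζ`, sheared by a map `h`. -/
theorem exists_sheared_chart (ψ : OpenPartialHomeomorph U₁ E₁) (ζ : OpenPartialHomeomorph U₂ E₂)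
    (hψ : ψ ∈ IsManifold.maximalAtlas 𝓘(ℝ, E₁) ∞ U₁)
    (hζ : ζ ∈ IsManifold.maximalAtlas 𝓘(ℝ, E₂) ∞ U₂) {O : Set U₂} (hO : IsOpen O) {h : U₂ → E₁}
    (hh : ContMDiffOn 𝓘(ℝ, E₂) 𝓘(ℝ, E₁) ∞ h O) :
    ∃ Φ ∈ IsManifold.maximalAtlas (𝓘(ℝ, E₁).prod 𝓘(ℝ, E₂)) ∞ (U₁ × U₂),
      Φ.source = ψ.source ×ˢ (ζ.source ∩ O) ∧ ∀ p : U₁ × U₂, Φ p = (ψ p.1 - h p.2, ζ p.2) := by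
  have hO' : IsOpen (ζ.target ∩ ζ.symm ⁻¹' O) := ζ.isOpen_inter_preimage_symm hO
  have hh' : ContMDiffOn (𝓘(ℝ, E₁).prod 𝓘(ℝ, E₂)) 𝓘(ℝ, E₁) ∞
      (fun r : E₁ × E₂ => r.1 + h (ζ.symm r.2)) (Prod.snd ⁻¹' (ζ.target ∩ ζ.symm ⁻¹' O)) := by
    refine contMDiffOn_fst.add ?_
    refine (hh.comp ((contMDiffOn_symm_of_mem_maximalAtlas hζ).mono fun b hb => hb.1)
      fun b hb => hb.2).comp contMDiffOn_snd fun r hr => hr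
  let Φ : OpenPartialHomeomorph (U₁ × U₂) (ModelProd E₁ E₂) :=
    { toFun := fun p => (ψ p.1 - h p.2, ζ p.2)
      invFun := fun r => (ψ.symm (r.1 + h (ζ.symm r.2)), ζ.symm r.2)
      source := ψ.source ×ˢ (ζ.source ∩ O)
      target := (Prod.snd ⁻¹' (ζ.target ∩ ζ.symm ⁻¹' O)) ∩
        (fun r : E₁ × E₂ => r.1 + h (ζ.symm r.2)) ⁻¹' ψ.target
      map_source' := by
        rintro ⟨u₁, u₂⟩ ⟨h₁, h₂, h₃⟩
        have h₄ := ζ.left_inv h₂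
        refine ⟨⟨ζ.map_source h₂, ?_⟩, ?_⟩
        · show ζ.symm (ζ u₂) ∈ O
          rwa [h₄]
        · show ψ u₁ - h u₂ + h (ζ.symm (ζ u₂)) ∈ ψ.target
          rw [h₄, sub_add_cancel]
          exact ψ.map_source h₁
      map_target' := by
        rintro ⟨a, b⟩ ⟨⟨h₁, h₂⟩, h₃⟩
        exact ⟨ψ.map_target h₃, ζ.map_target h₁, h₂⟩
      left_inv' := by
        rintro ⟨u₁, u₂⟩ ⟨h₁, h₂, h₃⟩
        refine Prod.ext ?_ (ζ.left_inv h₂)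
        show ψ.symm (ψ u₁ - h u₂ + h (ζ.symm (ζ u₂))) = u₁
        rw [ζ.left_inv h₂, sub_add_cancel, ψ.left_inv h₁]
      right_inv' := by
        rintro ⟨a, b⟩ ⟨⟨h₁, h₂⟩, h₃⟩
        refine Prod.ext ?_ (ζ.right_inv h₁)
        show ψ (ψ.symm (a + h (ζ.symm b))) - h (ζ.symm b) = a
        rw [ψ.right_inv h₃, add_sub_cancel_right]
      open_source := ψ.open_source.prod (ζ.open_source.inter hO)
      open_target := hh'.continuousOn.isOpen_inter_preimage (hO'.preimage continuous_snd)
        ψ.open_target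
      continuousOn_toFun := by
        refine ((ψ.continuousOn.comp continuousOn_fst fun p hp => hp.1).sub
          (hh.continuousOn.comp continuousOn_snd fun p hp => hp.2.2)).prodMk
          (ζ.continuousOn.comp continuousOn_snd fun p hp => hp.2.1)
      continuousOn_invFun := by
        refine (ψ.continuousOn_symm.comp (hh'.continuousOn.mono Set.inter_subset_left)
          fun r hr => hr.2).prodMk
          (ζ.continuousOn_symm.comp continuousOn_snd fun r hr => hr.1.1) }
  refine ⟨Φ, ?_, rfl, fun p => rfl⟩
  -- The model `E₁ × E₂` carries two charted space structures, as a model over itself and as a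
  -- product. Smoothness into or from a product refers to the second.
  have hc : chartedSpaceSelf (ModelProd E₁ E₂) = prodChartedSpace E₁ E₁ E₂ E₂ :=
    chartedSpaceSelf_prod.symm
  apply OpenPartialHomeomorph.mem_maximalAtlas_of_contMDiffOn
  · rw [hc]
    have h₁ : ContMDiffOn (𝓘(ℝ, E₁).prod 𝓘(ℝ, E₂)) 𝓘(ℝ, E₁) ∞
        (fun p : U₁ × U₂ => ψ p.1 - h p.2) (ψ.source ×ˢ (ζ.source ∩ O)) :=
      ((contMDiffOn_of_mem_maximalAtlas hψ).comp contMDiffOn_fst fun p hp => hp.1).sub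
        (hh.comp contMDiffOn_snd fun p hp => hp.2.2)
    exact h₁.prodMk
      ((contMDiffOn_of_mem_maximalAtlas hζ).comp contMDiffOn_snd fun p hp => hp.2.1)
  · rw [hc]
    exact ((contMDiffOn_symm_of_mem_maximalAtlas hψ).comp (hh'.mono Set.inter_subset_left)
      fun r hr => hr.2).prodMk
      ((contMDiffOn_symm_of_mem_maximalAtlas hζ).comp contMDiffOn_snd fun r hr => hr.1.1)

/-- The fibre product of a submersion and a smooth map is an embedded submanifold. -/
theorem exists_isSmoothEmbedding_fiberProduct [FiniteDimensional ℝ EM] [FiniteDimensional ℝ E₁]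
    [FiniteDimensional ℝ E₂] {q₁ : U₁ → M} {q₂ : U₂ → M}
    (h₁ : Manifold.IsSubmersion 𝓘(ℝ, E₁) 𝓘(ℝ, EM) ∞ q₁)
    (h₂ : ContMDiff 𝓘(ℝ, E₂) 𝓘(ℝ, EM) ∞ q₂) :
    ∃ (k : ℕ) (_ : ChartedSpace (EuclideanSpace ℝ (Fin k)) {p : U₁ × U₂ | q₁ p.1 = q₂ p.2}),
      IsManifold 𝓘(ℝ, EuclideanSpace ℝ (Fin k)) ∞ {p : U₁ × U₂ | q₁ p.1 = q₂ p.2} ∧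
      Manifold.IsSmoothEmbedding 𝓘(ℝ, EuclideanSpace ℝ (Fin k)) (𝓘(ℝ, E₁).prod 𝓘(ℝ, E₂)) ∞
        (Subtype.val : {p : U₁ × U₂ | q₁ p.1 = q₂ p.2} → U₁ × U₂) := by
  let d := Module.finrank ℝ E₁ - Module.finrank ℝ EM
  let k := d + Module.finrank ℝ E₂
  let L : EuclideanSpace ℝ (Fin k) ≃L[ℝ] EuclideanSpace ℝ (Fin d) × E₂ :=
    ContinuousLinearEquiv.ofFinrankEq (by simp [k])
  refine ⟨k, exists_isSmoothEmbedding_of_slices (F := EM) (𝓘(ℝ, E₁).prod 𝓘(ℝ, E₂)) ?_⟩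
  rintro ⟨u₁, u₂⟩ hu
  -- Rederiving the normal form from surjectivity fixes the complement to be `EuclideanSpace ℝ (Fin
  -- d)`, so that one dimension `k` serves at all points.
  obtain ⟨ψ, χ, e, hψ, hχ, hu₁, hs, hqψ⟩ := (h₁.contMDiff.isSubmersionAtOfComplement u₁
    (h₁.isSubmersionAt u₁).surjective_mfderiv).exists_charts
  -- With this shear, the base coordinate of `ψ u₁ - h u₂` is `χ (q₁ u₁) - χ (q₂ u₂)`, whose
  -- vanishing cuts out the fibre product.
  have hh : ContMDiffOn 𝓘(ℝ, E₂) 𝓘(ℝ, E₁) ∞ (fun u => e.symm (χ (q₂ u), 0))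
      (q₂ ⁻¹' χ.source) := by
    have h₃ : ContMDiff 𝓘(ℝ, EM) 𝓘(ℝ, E₁) ∞
        (fun m : EM => e.symm (m, (0 : EuclideanSpace ℝ (Fin d)))) :=
      (e.symm.contDiff.comp (contDiff_id.prodMk contDiff_const)).contMDiff
    exact h₃.comp_contMDiffOn ((contMDiffOn_of_mem_maximalAtlas hχ).comp h₂.contMDiffOn
      fun u hu => hu)
  obtain ⟨Φ, hΦ, hΦs, hΦe⟩ := exists_sheared_chart ψ (chartAt E₂ u₂) hψ
    (IsManifold.chart_mem_maximalAtlas u₂) (χ.open_source.preimage h₂.continuous) hh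
  let A : (EuclideanSpace ℝ (Fin k) × EM) ≃L[ℝ] E₁ × E₂ :=
    ((ContinuousLinearEquiv.prodComm ℝ _ _).trans
      (((ContinuousLinearEquiv.refl ℝ EM).prodCongr L).trans
        (ContinuousLinearEquiv.prodAssoc ℝ EM _ E₂).symm)).trans
      (e.symm.prodCongr (ContinuousLinearEquiv.refl ℝ E₂))
  have hA : ∀ v, (A.symm v).2 = (e v.1).1 := fun v => rfl
  refine ⟨Φ, hΦ, ?_, A, fun p hp => ?_⟩
  · rw [hΦs]
    refine ⟨hu₁, mem_chart_source E₂ u₂, ?_⟩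
    have := hs u₁ hu₁
    rwa [show q₁ u₁ = q₂ u₂ from hu] at this
  · rw [hΦs] at hp
    rw [hA, hΦe]
    show q₁ p.1 = q₂ p.2 ↔ (e (ψ p.1 - e.symm (χ (q₂ p.2), 0))).1 = 0
    rw [map_sub, e.apply_symm_apply, Prod.fst_sub, hqψ _ hp.1, sub_eq_zero]
    exact (χ.injOn.eq_iff (hs _ hp.1) hp.2.2).symm

end FiberProduct

/-! ### Vector fields along immersions -/

section Retraction

variable {F : Type*} [NormedAddCommGroup F] [NormedSpace ℝ F]
  {N : Type*} [TopologicalSpace N] [ChartedSpace F N]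
  {EX : Type*} [NormedAddCommGroup EX] [NormedSpace ℝ EX]
  {H : Type*} [TopologicalSpace H] {J : ModelWithCorners ℝ EX H}
  {X : Type*} [TopologicalSpace X] [ChartedSpace H X]

/-- An immersion has a local smooth left inverse. -/
theorem Manifold.IsImmersionAt.exists_retraction {f : N → X} {p : N}
    (hf : Manifold.IsImmersionAt 𝓘(ℝ, F) J ∞ f p) :
    ∃ r : X → N, ContMDiffAt J 𝓘(ℝ, F) ∞ r (f p) ∧ ∀ᶠ x in 𝓝 p, r (f x) = x := by
  have hx : ∀ x ∈ hf.domChart.source,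
      hf.equiv.symm (hf.codChart.extend J (f x)) = (hf.domChart x, 0) := by
    intro x hx
    have ht : hf.domChart x ∈ (hf.domChart.extend 𝓘(ℝ, F)).target := by
      simpa [OpenPartialHomeomorph.extend] using hf.domChart.map_source hx
    have h := hf.writtenInCharts ht
    have h₁ : hf.codChart.extend J (f (hf.domChart.symm (hf.domChart x))) =
      hf.equiv (hf.domChart x, 0) := h
    rw [hf.domChart.left_inv hx] at h₁
    rw [h₁, ContinuousLinearEquiv.symm_apply_apply]
  have hr : ∀ x ∈ hf.domChart.source,
      hf.domChart.symm (hf.equiv.symm (hf.codChart.extend J (f x))).1 = x := by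
    intro x h
    rw [hx x h, hf.domChart.left_inv h]
  refine ⟨fun y => hf.domChart.symm (hf.equiv.symm (hf.codChart.extend J y)).1, ?_, ?_⟩
  · have h₁ : ContMDiffAt J 𝓘(ℝ, F) ∞ (fun y => (hf.equiv.symm (hf.codChart.extend J y)).1) (f p) :=
      (contDiff_fst.comp hf.equiv.symm.contDiff).contMDiff.contMDiffAt.comp (f p)
        (hf.codChart.contMDiffAt_extend hf.codChart_mem_maximalAtlas hf.mem_codChart_source)
    refine ContMDiffAt.comp (f p) (g := hf.domChart.symm) ?_ h₁
    rw [hx p hf.mem_domChart_source]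
    exact contMDiffAt_symm_of_mem_maximalAtlas hf.domChart_mem_maximalAtlas
      (hf.domChart.map_source hf.mem_domChart_source)
  · filter_upwards [hf.domChart.open_source.mem_nhds hf.mem_domChart_source] with x h using hr x h

/-- Vector fields which an immersion maps to a smooth vector field are smooth. -/
theorem Manifold.IsImmersion.isSmoothVF_of_isRelated [IsManifold 𝓘(ℝ, F) ∞ N] [IsManifold J ∞ X]
    {f : N → X}
    (hf : Manifold.IsImmersion 𝓘(ℝ, F) J ∞ f) {Z : (p : N) → TangentSpace 𝓘(ℝ, F) p}
    {V : (x : X) → TangentSpace J x}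
    (hV : ContMDiff J J.tangent ∞ (fun x => (⟨x, V x⟩ : TangentBundle J X)))
    (hZ : ∀ p, mfderiv 𝓘(ℝ, F) J f p (Z p) = V (f p)) : IsSmoothVF Z := by
  intro p₀
  have : IsManifold J 1 X := IsManifold.of_le (n := ∞) (by simp)
  have : IsManifold 𝓘(ℝ, F) 1 N := IsManifold.of_le (n := ∞) (by simp)
  obtain ⟨r, hr, hrf⟩ := (hf.isImmersionAt p₀).exists_retraction
  have hr₀ : r (f p₀) = p₀ := hrf.self_of_nhds
  rw [contMDiffAt_section_iff_mfderiv_extChartAt]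
  set χ := extChartAt 𝓘(ℝ, F) p₀
  -- Near `p₀` one has `χ = χ ∘ r ∘ f`, so the chart components of `Z` are those of `d(χ ∘ r) V`
  -- along `f`, which are smooth.
  have hρ : ContMDiffAt J 𝓘(ℝ, F) ∞ (χ ∘ r) (f p₀) := by
    refine ContMDiffAt.comp (f p₀) ?_ hr
    rw [hr₀]
    exact contMDiffAt_extChartAt
  have h₁ := (hρ.mfderiv_apply_section (hV (f p₀))).comp p₀ hf.contMDiff.contMDiffAt
  refine h₁.congr_of_eventuallyEq ?_
  have hd : ∀ᶠ x in 𝓝 (f p₀), ContMDiffAt J 𝓘(ℝ, F) 1 (χ ∘ r) x :=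
    (contMDiffAt_iff_contMDiffAt_nhds (by simp)).1 (hρ.of_le (by simp))
  filter_upwards [eventually_eventually_nhds.2 hrf,
    hf.contMDiff.continuous.continuousAt.eventually hd] with p hp hdp
  have h₂ : χ =ᶠ[𝓝 p] (χ ∘ r) ∘ f := hp.mono fun x hx => congrArg χ hx.symm
  have h₃ := mfderiv_comp p (hdp.mdifferentiableAt (by simp))
    (hf.contMDiff.mdifferentiableAt (x := p) (by simp))
  have h₄ := (h₂.mfderiv_eq (I := 𝓘(ℝ, F)) (I' := 𝓘(ℝ, F))).trans h₃
  refine (congrArg (fun L : F →L[ℝ] F => L (Z p)) h₄).trans ?_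
  exact congrArg (fun v => mfderiv J 𝓘(ℝ, F) (χ ∘ r) (f p) v) (hZ p)

end Retraction

/-! ### Tangent vectors and vector fields on the fibre product -/

section FiberProduct

variable {EM : Type*} [NormedAddCommGroup EM] [NormedSpace ℝ EM]
  {M : Type*} [TopologicalSpace M] [ChartedSpace EM M] [IsManifold 𝓘(ℝ, EM) ∞ M]
  {E₁ : Type*} [NormedAddCommGroup E₁] [NormedSpace ℝ E₁]
  {U₁ : Type*} [TopologicalSpace U₁] [ChartedSpace E₁ U₁] [IsManifold 𝓘(ℝ, E₁) ∞ U₁]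
  {E₂ : Type*} [NormedAddCommGroup E₂] [NormedSpace ℝ E₂]
  {U₂ : Type*} [TopologicalSpace U₂] [ChartedSpace E₂ U₂] [IsManifold 𝓘(ℝ, E₂) ∞ U₂]
  {F : Type*} [NormedAddCommGroup F] [NormedSpace ℝ F]
  {q₁ : U₁ → M} {q₂ : U₂ → M} {W : Set (U₁ × U₂)} [ChartedSpace F W] [IsManifold 𝓘(ℝ, F) ∞ W]

open Classical in
-- Take a curve with velocity `v₂` in `U₂` and lift its image in `M` through the submersion `q₁`
-- with initial velocity `v₁`. The pair of curves lies in `W`, and is smooth there because `W` is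
-- embedded. Fields are built pointwise in this way; being related to a smooth field on the product,
-- they are smooth.
theorem Manifold.IsSmoothEmbedding.isSmoothFiberProduct
    (hF : Manifold.IsSmoothEmbedding 𝓘(ℝ, F) (𝓘(ℝ, E₁).prod 𝓘(ℝ, E₂)) ∞
      (Subtype.val : W → U₁ × U₂))
    (hW : ∀ p, p ∈ W ↔ q₁ p.1 = q₂ p.2)
    (h₁ : Manifold.IsSubmersion 𝓘(ℝ, E₁) 𝓘(ℝ, EM) ∞ q₁)
    (h₂ : ContMDiff 𝓘(ℝ, E₂) 𝓘(ℝ, EM) ∞ q₂) :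
    IsSmoothFiberProduct (EM := EM) (E₁ := E₁) (E₂ := E₂) (F := F) q₁ q₂
      (fun p : W => p.1.1) (fun p => p.1.2) := by
  have hs₁ : ContMDiff 𝓘(ℝ, F) 𝓘(ℝ, E₁) ∞
      (fun p : W => p.1.1) := contMDiff_fst.comp hF.contMDiff
  have hs₂ : ContMDiff 𝓘(ℝ, F) 𝓘(ℝ, E₂) ∞
      (fun p : W => p.1.2) := contMDiff_snd.comp hF.contMDiff
  have htan : ∀ (p : W) (v₁ : TangentSpace 𝓘(ℝ, E₁) p.1.1)
      (v₂ : TangentSpace 𝓘(ℝ, E₂) p.1.2),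
      (mfderiv 𝓘(ℝ, E₁) 𝓘(ℝ, EM) q₁ p.1.1 v₁ : EM) = (mfderiv 𝓘(ℝ, E₂) 𝓘(ℝ, EM) q₂ p.1.2 v₂ : EM) →
      ∃ w : TangentSpace 𝓘(ℝ, F) p,
        mfderiv 𝓘(ℝ, F) 𝓘(ℝ, E₁) (fun p : W => p.1.1) p w = v₁ ∧
        mfderiv 𝓘(ℝ, F) 𝓘(ℝ, E₂) (fun p : W => p.1.2) p w = v₂ := by
    intro p v₁ v₂ hv
    obtain ⟨γ₂, hγ₂⟩ := exists_hasVelocity p.1.2 v₂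
    have hc := (hγ₂.comp (h₂ p.1.2)).cast (y := q₁ p.1.1) ((hW p).1 p.2).symm
    have hc' : HasVelocity (q₂ ∘ γ₂) (q₁ p.1.1) (mfderiv 𝓘(ℝ, E₁) 𝓘(ℝ, EM) q₁ p.1.1 v₁) :=
      ⟨hc.1, hc.2.1, hc.2.2.trans hv.symm⟩
    obtain ⟨γ₁, hγ₁, hq⟩ := (h₁.isSubmersionAt p.1.1).exists_lift_curve v₁ hc'
    -- The curves match only near `0`; elsewhere the value `p` is a mere default.
    let δ : ℝ → W := fun τ =>
      if h : q₁ (γ₁ τ) = q₂ (γ₂ τ) then ⟨(γ₁ τ, γ₂ τ), (hW _).2 h⟩ else p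
    have hδ : ∀ᶠ τ in 𝓝 0, (δ τ : U₁ × U₂) = (γ₁ τ, γ₂ τ) := by
      filter_upwards [hq] with τ hτ
      exact congrArg Subtype.val (dif_pos hτ)
    have hδ₀ : δ 0 = p :=
      Subtype.ext (hδ.self_of_nhds.trans (Prod.ext hγ₁.1 hγ₂.1))
    have hvs : ContMDiffAt 𝓘(ℝ, ℝ) (𝓘(ℝ, E₁).prod 𝓘(ℝ, E₂)) ∞ (Subtype.val ∘ δ) 0 :=
      (hγ₁.2.1.prodMk hγ₂.2.1).congr_of_eventuallyEq hδ
    have hδs : ContMDiffAt 𝓘(ℝ, ℝ) 𝓘(ℝ, F) ∞ δ 0 :=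
      (ContMDiffAt.iff_comp_isImmersionAt (hF.isImmersion.isImmersionAt (δ 0))).2
        ⟨(hF.isEmbedding.continuousAt_iff).2 hvs.continuousAt, hvs⟩
    have hδv : HasVelocity (E := F) δ p (mfderiv 𝓘(ℝ, ℝ) 𝓘(ℝ, F) δ 0 (1 : ℝ) : F) :=
      ⟨hδ₀, hδs, rfl⟩
    exact ⟨_, (hδv.comp (hs₁ p)).unique hγ₁ (hδ.mono fun τ h => congrArg Prod.fst h),
      (hδv.comp (hs₂ p)).unique hγ₂ (hδ.mono fun τ h => congrArg Prod.snd h)⟩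
  refine ⟨hs₁, hs₂, fun p => (hW p).1 p.2, htan, fun Z₁ Z₂ hZ₁ hZ₂ hZ => ?_⟩
  choose Z hZ₁' hZ₂' using fun p => htan p (Z₁ p.1.1) (Z₂ p.1.2) (hZ p)
  refine ⟨Z, hF.isImmersion.isSmoothVF_of_isRelated (contMDiff_prod_section hZ₁ hZ₂) fun p => ?_,
    hZ₁', hZ₂'⟩
  have h := mfderiv_prodMk (hs₁.mdifferentiableAt (x := p) (by simp))
    (hs₂.mdifferentiableAt (x := p) (by simp))
  exact (congrArg (fun L : F →L[ℝ] E₁ × E₂ => L (Z p)) h).trans (Prod.ext (hZ₁' p) (hZ₂' p))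

end FiberProduct

end

theorem mainTheorem12
    {EM : Type*} [NormedAddCommGroup EM] [NormedSpace ℝ EM] [FiniteDimensional ℝ EM]
    {EG : Type*} [NormedAddCommGroup EG] [NormedSpace ℝ EG] [FiniteDimensional ℝ EG]
    {M : Type*} [TopologicalSpace M] [ChartedSpace EM M] [IsManifold 𝓘(ℝ, EM) ∞ M]
    [T2Space M] [SecondCountableTopology M]
    {G : Type*} [TopologicalSpace G] [ChartedSpace EG G] [IsManifold 𝓘(ℝ, EG) ∞ G]
    (𝒢 : LieGrpd EM EG M G) (B : SingularSubalgebroid 𝒢)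
    {E₁ : Type*} [NormedAddCommGroup E₁] [NormedSpace ℝ E₁] [FiniteDimensional ℝ E₁]
    {U₁ : Type*} [TopologicalSpace U₁] [ChartedSpace E₁ U₁] [IsManifold 𝓘(ℝ, E₁) ∞ U₁]
    [T2Space U₁] [SecondCountableTopology U₁]
    {E₂ : Type*} [NormedAddCommGroup E₂] [NormedSpace ℝ E₂] [FiniteDimensional ℝ E₂]
    {U₂ : Type*} [TopologicalSpace U₂] [ChartedSpace E₂ U₂] [IsManifold 𝓘(ℝ, E₂) ∞ U₂]
    [T2Space U₂] [SecondCountableTopology U₂]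
    (φ₁ : U₁ → G) (hφ₁ : IsBisubmersion (EU := E₁) B φ₁)
    (φ₂ : U₂ → G) (hφ₂ : IsBisubmersion (EU := E₂) B φ₂) :
    -- the fibre product is an embedded submanifold of `U₁ × U₂`
    (∃ (k : ℕ) (_ : ChartedSpace (EuclideanSpace ℝ (Fin k)) (𝒢.fiberProd φ₁ φ₂)),
      IsManifold 𝓘(ℝ, EuclideanSpace ℝ (Fin k)) ∞ (𝒢.fiberProd φ₁ φ₂) ∧
      Manifold.IsSmoothEmbedding 𝓘(ℝ, EuclideanSpace ℝ (Fin k)) (𝓘(ℝ, E₁).prod 𝓘(ℝ, E₂)) ∞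
        (Subtype.val : 𝒢.fiberProd φ₁ φ₂ → U₁ × U₂)) ∧
    -- for its submanifold structure, the composition is a bisubmersion
    (∀ (F : Type*) [NormedAddCommGroup F] [NormedSpace ℝ F] [FiniteDimensional ℝ F]
      [ChartedSpace F (𝒢.fiberProd φ₁ φ₂)] [IsManifold 𝓘(ℝ, F) ∞ (𝒢.fiberProd φ₁ φ₂)],
      Manifold.IsSmoothEmbedding 𝓘(ℝ, F) (𝓘(ℝ, E₁).prod 𝓘(ℝ, E₂)) ∞
        (Subtype.val : 𝒢.fiberProd φ₁ φ₂ → U₁ × U₂) →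
      IsBisubmersion (EU := F) B (𝒢.compMap φ₁ φ₂)) ∧
    -- the inverse of a bisubmersion is a bisubmersion
    IsBisubmersion (EU := E₁) B (𝒢.inv ∘ φ₁) := by
  have hsrc := hφ₁.src_submersion
  have htgt := hφ₂.tgt_submersion.contMDiff
  refine ⟨exists_isSmoothEmbedding_fiberProduct hsrc htgt, ?_, hφ₁.inv⟩
  intro F _ _ _ _ _ hF
  have hN := Manifold.IsSmoothEmbedding.isSmoothFiberProduct (q₁ := 𝒢.src ∘ φ₁)
    (q₂ := 𝒢.tgt ∘ φ₂) hF (fun p => Iff.rfl) hsrc htgt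
  exact hN.isBisubmersion_mul hφ₁ hφ₂
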